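/- For a finite group $G$ let $\operatorname{Irr} G$ denote the (finite) set of isomorphism classes of finite-dimensional irreducible complex representations of $G$, and define the representation zeta function of $G$ by $$R_G(\mathcal D)=\sum_{\rho\in\operatorname{Irr}G}\mathcal D^{\dim\rho}\in\mathbb Z[\mathcal D].$$ Let $F$ and $F'$ be non-Archimedean local fields (with finite residue fields) with rings of integers $\mathcal O$ and $\mathcal O'$, whose maximal ideals are $\wp$ and $\wp'$, and put $\mathcal O_2=\mathcal O/\wp^2$ and $\mathcal O_2'=\mathcal O'/\wp'^2$. Suppose that the residue fields have the same order, $|\mathcal O/\wp|=|\mathcal O'/\wp'|$. Then for every natural number $n$ $$R_{\mathrm{GL}_n(\mathcal O_2)}(\mathcal D)=R_{\mathrm{GL}_n(\mathcal O_2')}(\mathcal D)\quad\text{in }\mathbb Z[\mathcal D].$$ Equivalently, the multisets $\{\dim\rho : \rho\in\operatorname{Irr}\mathrm{GL}_n(\mathcal O_2)\}$ and $\{\dim\rho : \rho\in\operatorname{Irr}\mathrm{GL}_n(\mathcal O_2')\}$ coincide, so for given $n$ the multiset of irreducible dimensions depends only on the order $q$ of the residue field. -/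

import Mathlib

open scoped ValuativeRel MatrixGroups

noncomputable section

/-- A finite-dimensional irreducible complex representation of a group `G`
(in particular, its space is nonzero). -/
structure IrrepC (G : Type*) [Group G] where
  /-- The underlying complex vector space. -/
  V : Type
  [addCommGroup : AddCommGroup V]
  [module : Module ℂ V]
  [finiteDimensional : FiniteDimensional ℂ V]
  /-- The action of `G`. -/
  ρ : Representation ℂ G V
  irreducible : ρ.IsIrreducible

attribute [instance] IrrepC.addCommGroup IrrepC.module IrrepC.finiteDimensional
  IrrepC.irreducible

/-- Isomorphism of representations. -/
instance IrrepC.setoid (G : Type*) [Group G] : Setoid (IrrepC G) where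
  r σ τ := Nonempty (σ.ρ.Equiv τ.ρ)
  iseqv :=
    { refl := fun σ => ⟨.refl σ.ρ⟩
      symm := fun ⟨e⟩ => ⟨e.symm⟩
      trans := fun ⟨e⟩ ⟨f⟩ => ⟨e.trans f⟩ }

/-- `Irr G`: the set of isomorphism classes of finite-dimensional irreducible complex
representations of `G`. -/
def IrrC (G : Type*) [Group G] : Type _ := Quotient (IrrepC.setoid G)

/-- The dimension of an isomorphism class of irreducible representations. -/
def IrrC.dim {G : Type*} [Group G] : IrrC G → ℕ :=
  Quotient.lift (fun σ => Module.finrank ℂ σ.V) fun _ _ ⟨e⟩ => e.toLinearEquiv.finrank_eq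

/-- The character of an isomorphism class of irreducible representations. -/
def IrrC.character {G : Type*} [Group G] : IrrC G → G → ℂ :=
  Quotient.lift (fun σ => σ.ρ.character) fun _ _ ⟨e⟩ => Representation.char_iso e

theorem IrrC.linearIndependent_character (G : Type*) [Group G] [Finite G] :
    LinearIndependent ℂ (IrrC.character (G := G)) := by
  classical
  have := Fintype.ofFinite G
  have : Invertible (Nat.card G : ℂ) :=
    invertibleOfNonzero (by simp)
  have orth : ∀ a b : IrrC G, (Nat.card G : ℂ)⁻¹ * ∑ g : G, a.character g * b.character g⁻¹ =
      if a = b then 1 else 0 := by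
    intro a b
    induction a using Quotient.inductionOn with | _ σ
    induction b using Quotient.inductionOn with | _ τ
    refine (Representation.char_orthonormal σ.ρ τ.ρ).trans (if_congr ?_ rfl rfl)
    exact ⟨fun h => (Quotient.sound h).symm, fun h => Quotient.exact h.symm⟩
  rw [linearIndependent_iff']
  intro s c hc b hb
  have h : (Nat.card G : ℂ)⁻¹ * ∑ g : G, (∑ a ∈ s, c a • a.character) g * b.character g⁻¹ = 0 := by
    rw [hc]
    simp
  have h2 : (Nat.card G : ℂ)⁻¹ * ∑ g : G, (∑ a ∈ s, c a • a.character) g * b.character g⁻¹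
      = ∑ a ∈ s, c a * ((Nat.card G : ℂ)⁻¹ * ∑ g : G, a.character g * b.character g⁻¹) := by
    simp only [Finset.sum_apply, Pi.smul_apply, smul_eq_mul, Finset.sum_mul, Finset.mul_sum]
    rw [Finset.sum_comm]
    refine Finset.sum_congr rfl fun a _ => Finset.sum_congr rfl fun g _ => by ring
  rw [h2] at h
  simp only [orth] at h
  simpa [hb] using h

/-- A finite group has finitely many isomorphism classes of irreducible representations. -/
instance IrrC.fintype (G : Type*) [Group G] [Finite G] : Fintype (IrrC G) :=
  have : Finite (IrrC G) := (IrrC.linearIndependent_character G).finite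
  Fintype.ofFinite _

open Polynomial in
/-- The representation zeta function `R_G(D) = ∑_{ρ ∈ Irr G} D ^ dim ρ ∈ ℤ[D]` of a finite
group `G`. -/
def repZeta (G : Type*) [Group G] [Finite G] : ℤ[X] :=
  ∑ σ : IrrC G, X ^ σ.dim

/-- The multiset of dimensions of the irreducible representations of a finite group `G`. -/
def irrDims (G : Type*) [Group G] [Finite G] : Multiset ℕ :=
  (Finset.univ : Finset (IrrC G)).val.map IrrC.dim

/-- The ring `𝒪₂ = 𝒪 / ℘²` for the ring of integers `𝒪` of a local field, with maximal ideal
`℘`. -/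
abbrev OTwo (F : Type*) [Field F] [ValuativeRel F] : Type _ := 𝒪[F] ⧸ (𝓂[F] ^ 2 : Ideal 𝒪[F])

instance OTwo.finite (F : Type*) [Field F] [ValuativeRel F] [TopologicalSpace F]
    [IsNonarchimedeanLocalField F] : Finite (OTwo F) :=
  have : Finite (𝒪[F] ⧸ 𝓂[F]) := inferInstanceAs (Finite 𝓀[F])
  Ideal.finite_quotient_pow (IsNoetherian.noetherian _) _

instance GLOTwo.finite (n : ℕ) (F : Type*) [Field F] [ValuativeRel F] [TopologicalSpace F]
    [IsNonarchimedeanLocalField F] : Finite (GL (Fin n) (OTwo F)) :=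
  inferInstanceAs (Finite (Matrix (Fin n) (Fin n) (OTwo F))ˣ)

end

/-! Write `R` for the ring of integers modulo the square of its maximal ideal and `k` for its
residue field. Reduction makes `GL n R` an extension of `GL n k` by the abelian group of matrices `1
+ inc X`, a copy of the additive group of `n × n` matrices over `k` on which `GL n k` acts by
conjugation. The extension need not split, but its complex group algebra is always that of the split
extension, which depends on `k` alone. Finite fields of equal order are isomorphic, so the two group
algebras are isomorphic, and isomorphic group algebras have the same simple modules with the same
dimensions.

The comparison with the split extension (`nonempty_algEquiv_semidirectProduct`) is a form of
Clifford theory. If every character of the abelian kernel extends to its stabilizer, the extensions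
assemble to a scalar cocycle on the action groupoid of the dual. Dividing each group element by this
cocycle yields elements of the group algebra that multiply like the quotient group and conjugate the
kernel as before.

It remains to extend characters (`SquareZeroExtension.characterExtends`). Each one is `X ↦ ψ (tr (A
X))`, with stabilizer the preimage of the centralizer of `A`. Enlarging `R` and `k` so that the
characteristic polynomial of `A` splits, and conjugating, reduces to a Jordan matrix `D + N`. A
matrix commutes with it exactly when certain entries vanish and others agree, so entrywise lifting
turns its centralizer into matrices over `R` commuting with the 0-1 lifts of `N` and of the
eigenprojections. On the group `H` of such matrices, characters of the determinants on the
generalized eigenspaces have the prescribed restriction, because `tr (N X) = 0` whenever `X`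
commutes with the nilpotent `N`. Since `H` and the congruence subgroup generate the stabilizer, the
two characters glue (`characterExtends_jordan`). -/

namespace Representation

/-! ### Irreducible representations under isomorphisms of group algebras -/

open scoped MonoidAlgebra

variable {𝕜 G H V W : Type*} [Field 𝕜] [Group G] [Group H] [AddCommGroup V] [Module 𝕜 V]
  [AddCommGroup W] [Module 𝕜 W]

theorem asAlgebraHom_mem_subrepresentation {ρ : Representation 𝕜 G V} (S : Subrepresentation ρ)
    (x : 𝕜[G]) {v : V} (hv : v ∈ S.toSubmodule) : ρ.asAlgebraHom x v ∈ S.toSubmodule := by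
  induction x using MonoidAlgebra.induction_on with
  | of g => simpa using S.apply_mem_toSubmodule g hv
  | add x y hx hy => simpa using add_mem hx hy
  | smul r x hx => simpa using S.toSubmodule.smul_mem r hx

/-- Restriction of a representation along a homomorphism of group algebras. -/
noncomputable def comapAlgHom (α : 𝕜[G] →ₐ[𝕜] 𝕜[H]) (τ : Representation 𝕜 H V) :
    Representation 𝕜 G V :=
  ((τ.asAlgebraHom.comp α : 𝕜[G] →* Module.End 𝕜 V)).comp (MonoidAlgebra.of 𝕜 G)

theorem comapAlgHom_apply (α : 𝕜[G] →ₐ[𝕜] 𝕜[H]) (τ : Representation 𝕜 H V) (g : G) :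
    comapAlgHom α τ g = τ.asAlgebraHom (α (MonoidAlgebra.of 𝕜 G g)) := rfl

theorem asAlgebraHom_comapAlgHom (α : 𝕜[G] →ₐ[𝕜] 𝕜[H]) (τ : Representation 𝕜 H V) (x : 𝕜[G]) :
    (comapAlgHom α τ).asAlgebraHom x = τ.asAlgebraHom (α x) := by
  have : (comapAlgHom α τ).asAlgebraHom = τ.asAlgebraHom.comp α := by
    ext g : 2
    simp [comapAlgHom_apply]
  rw [this]; rfl

theorem comapAlgHom_comapAlgHom_symm (α : 𝕜[G] ≃ₐ[𝕜] 𝕜[H]) (τ : Representation 𝕜 H V) :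
    comapAlgHom (α.symm : 𝕜[H] →ₐ[𝕜] 𝕜[G]) (comapAlgHom (α : 𝕜[G] →ₐ[𝕜] 𝕜[H]) τ) = τ := by
  ext1 h
  rw [comapAlgHom_apply, asAlgebraHom_comapAlgHom]
  simp

/-- Subrepresentations do not change under restriction along an isomorphism of group algebras. -/
noncomputable def subrepresentationComapEquiv (α : 𝕜[G] ≃ₐ[𝕜] 𝕜[H])
    (τ : Representation 𝕜 H V) :
    Subrepresentation τ ≃o Subrepresentation (comapAlgHom (α : 𝕜[G] →ₐ[𝕜] 𝕜[H]) τ) where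
  toFun S := ⟨S.toSubmodule, fun g v hv => asAlgebraHom_mem_subrepresentation S _ hv⟩
  invFun S := ⟨S.toSubmodule, fun h v hv => by
    have := asAlgebraHom_mem_subrepresentation S (α.symm (MonoidAlgebra.of 𝕜 H h)) hv
    rw [asAlgebraHom_comapAlgHom] at this
    simpa using this⟩
  left_inv S := rfl
  right_inv S := rfl
  map_rel_iff' := Iff.rfl

theorem IsIrreducible.comapAlgHom (α : 𝕜[G] ≃ₐ[𝕜] 𝕜[H]) {τ : Representation 𝕜 H V}
    (hτ : τ.IsIrreducible) : (comapAlgHom (α : 𝕜[G] →ₐ[𝕜] 𝕜[H]) τ).IsIrreducible :=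
  (subrepresentationComapEquiv α τ).symm.isSimpleOrder

theorem Equiv.asAlgebraHom_apply {ρ : Representation 𝕜 G V} {σ : Representation 𝕜 G W}
    (e : ρ.Equiv σ) (x : 𝕜[G]) (v : V) :
    e.toLinearEquiv (ρ.asAlgebraHom x v) = σ.asAlgebraHom x (e.toLinearEquiv v) := by
  induction x using MonoidAlgebra.induction_on with
  | of g =>
    simpa using IntertwiningMap.isIntertwining _ _ e.toIntertwiningMap g v
  | add x y hx hy => simp only [map_add, LinearMap.add_apply, hx, hy]
  | smul r x hx => simp only [map_smul, LinearMap.smul_apply, hx]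

theorem nonempty_equiv_comapAlgHom (α : 𝕜[G] →ₐ[𝕜] 𝕜[H]) {σ : Representation 𝕜 H V}
    {τ : Representation 𝕜 H W} (e : σ.Equiv τ) :
    Nonempty ((comapAlgHom α σ).Equiv (comapAlgHom α τ)) :=
  ⟨.mk e.toLinearEquiv fun _ => LinearMap.ext fun v => e.asAlgebraHom_apply _ v⟩

end Representation

section

open Representation MonoidAlgebra

variable {G H : Type*} [Group G] [Group H]

/-- Restriction of an irreducible representation along an isomorphism of group algebras. -/
noncomputable def IrrepC.comap (α : MonoidAlgebra ℂ G ≃ₐ[ℂ] MonoidAlgebra ℂ H) (τ : IrrepC H) :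
    IrrepC G where
  V := τ.V
  ρ := comapAlgHom (α : MonoidAlgebra ℂ G →ₐ[ℂ] MonoidAlgebra ℂ H) τ.ρ
  irreducible := τ.irreducible.comapAlgHom α

/-- An isomorphism of group algebras induces a map on isomorphism classes of irreducible
representations. -/
noncomputable def IrrC.comap (α : MonoidAlgebra ℂ G ≃ₐ[ℂ] MonoidAlgebra ℂ H) :
    IrrC H → IrrC G :=
  Quotient.map (IrrepC.comap α) fun σ τ ⟨e⟩ =>
    nonempty_equiv_comapAlgHom (α : MonoidAlgebra ℂ G →ₐ[ℂ] MonoidAlgebra ℂ H)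
      (σ := σ.ρ) (τ := τ.ρ) e

theorem IrrC.comap_comap_symm (α : MonoidAlgebra ℂ G ≃ₐ[ℂ] MonoidAlgebra ℂ H) (τ : IrrC H) :
    IrrC.comap α.symm (IrrC.comap α τ) = τ := by
  induction τ using Quotient.inductionOn with | _ τ
  refine Quotient.sound ?_
  have := comapAlgHom_comapAlgHom_symm α τ.ρ
  exact ⟨.mk (.refl ℂ τ.V) fun g => LinearMap.ext fun v =>
    congrArg (fun ρ : Representation ℂ H τ.V => ρ g v) this⟩

/-- Isomorphic group algebras have the same irreducible representations. -/
noncomputable def IrrC.equivOfAlgEquiv (α : MonoidAlgebra ℂ G ≃ₐ[ℂ] MonoidAlgebra ℂ H) :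
    IrrC H ≃ IrrC G where
  toFun := IrrC.comap α
  invFun := IrrC.comap α.symm
  left_inv := IrrC.comap_comap_symm α
  right_inv := IrrC.comap_comap_symm α.symm

theorem IrrC.dim_equivOfAlgEquiv (α : MonoidAlgebra ℂ G ≃ₐ[ℂ] MonoidAlgebra ℂ H) (τ : IrrC H) :
    (IrrC.equivOfAlgEquiv α τ).dim = τ.dim := by
  induction τ using Quotient.inductionOn with | _ τ
  rfl

theorem repZeta_eq_of_algEquiv [Finite G] [Finite H]
    (α : MonoidAlgebra ℂ G ≃ₐ[ℂ] MonoidAlgebra ℂ H) : repZeta G = repZeta H :=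
  (Fintype.sum_equiv (IrrC.equivOfAlgEquiv α) _ _
    fun τ => by rw [IrrC.dim_equivOfAlgEquiv]).symm

theorem irrDims_eq_of_algEquiv [Finite G] [Finite H]
    (α : MonoidAlgebra ℂ G ≃ₐ[ℂ] MonoidAlgebra ℂ H) : irrDims G = irrDims H := by
  have h := congrArg Finset.val (Finset.map_univ_equiv (IrrC.equivOfAlgEquiv α))
  unfold irrDims
  rw [← h, Finset.map_val, Multiset.map_map]
  exact Multiset.map_congr rfl fun τ _ => IrrC.dim_equivOfAlgEquiv α τ

end

/-! ### From characters of stabilizers to a groupoid cocycle -/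

/-- If the characters `ψ ω` extend to the stabilizers of `ω`, they extend to a multiplicative
cocycle on the action groupoid. -/
theorem exists_groupoid_character {G Ω N A : Type*} [Group G] [MulAction G Ω] [CommGroup A]
    (ι : N → G) (ψ : Ω → N → A) (hιω : ∀ x (ω : Ω), ι x • ω = ω)
    (hι : ∀ g x, ∃ y, g * ι x * g⁻¹ = ι y)
    (hψ : ∀ g (ω : Ω) x y, g * ι x * g⁻¹ = ι y → ψ (g • ω) y = ψ ω x)
    (hext : ∀ ω : Ω, ∃ f : G → A,
      (∀ g h, g • ω = ω → h • ω = ω → f (g * h) = f g * f h) ∧ ∀ x, f (ι x) = ψ ω x) :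
    ∃ w : G → Ω → A, (∀ g h ω, w (g * h) ω = w g (h • ω) * w h ω) ∧
      ∀ x ω, w (ι x) ω = ψ ω x := by
  classical
  choose f hf hfι using hext
  -- `c ω` is a chosen representative of the orbit of `ω`, and `r ω` below carries it to `ω`.
  let c : Ω → Ω := fun ω => (Quotient.mk (MulAction.orbitRel G Ω) ω).out
  have hc : ∀ g ω, c (g • ω) = c ω := fun g ω =>
    congrArg Quotient.out (Quotient.sound (MulAction.mem_orbit ω g))
  have hr : ∀ ω, ∃ r : G, r • c ω = ω := fun ω => by
    have h : (MulAction.orbitRel G Ω).r (c ω) ω := Quotient.exact (Quotient.out_eq _)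
    obtain ⟨g, hg⟩ := h
    exact ⟨g⁻¹, by rw [← hg]; simp⟩
  choose r hr using hr
  have hstab : ∀ g ω, ((r (g • ω))⁻¹ * g * r ω) • c ω = c ω := fun g ω => by
    rw [mul_smul, mul_smul, hr ω, inv_smul_eq_iff]
    conv_rhs => rw [← hc g ω]
    exact (hr _).symm
  -- The arrow from `ω` to `g • ω` is brought back to a loop at the orbit representative, where the
  -- extended character is multiplicative.
  refine ⟨fun g ω => f (c ω) ((r (g • ω))⁻¹ * g * r ω), fun g h ω => ?_, fun x ω => ?_⟩
  · dsimp only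
    rw [hc h ω, ← hf (c ω)]
    · rw [mul_smul]
      congr 1
      group
    · have := hstab g (h • ω)
      rwa [hc h ω] at this
    · exact hstab h ω
  · dsimp only
    obtain ⟨y, hy⟩ := hι (r ω)⁻¹ x
    rw [hιω]
    rw [inv_inv] at hy
    rw [hy, hfι]
    have := hψ (r ω) (c ω) y x (by rw [← hy]; group)
    rw [← this, hr]

/-! ### Orthogonality of characters of finite abelian groups -/

section Orthogonality

variable {N : Type*} [CommGroup N]

theorem hasEnoughRootsOfUnity_complex [Finite N] : HasEnoughRootsOfUnity ℂ (Monoid.exponent N) :=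
  have : NeZero (Monoid.exponent N) := ⟨Monoid.exponent_ne_zero_of_finite⟩
  inferInstance

theorem sum_character_apply [Finite N] [Fintype (N →* ℂˣ)] [DecidableEq N] (x : N) :
    ∑ χ : N →* ℂˣ, (χ x : ℂ) = if x = 1 then (Nat.card N : ℂ) else 0 := by
  have := hasEnoughRootsOfUnity_complex (N := N)
  split_ifs with hx
  · subst hx
    simp [← Nat.card_eq_fintype_card, CommGroup.card_monoidHom_of_hasEnoughRootsOfUnity]
  · obtain ⟨χ₀, h₀⟩ := CommGroup.exists_apply_ne_one_of_hasEnoughRootsOfUnity N ℂ hx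
    have h : ∑ χ : N →* ℂˣ, (χ x : ℂ) = χ₀ x * ∑ χ : N →* ℂˣ, (χ x : ℂ) := by
      rw [Finset.mul_sum]
      refine (Fintype.sum_equiv (Equiv.mulLeft χ₀) _ _ fun χ => ?_).symm
      simp
    have h' : ((χ₀ x : ℂ) - 1) * ∑ χ : N →* ℂˣ, (χ x : ℂ) = 0 := by
      rw [sub_mul, one_mul, ← h, sub_self]
    refine (mul_eq_zero.mp h').resolve_left fun h => h₀ (Units.ext ?_)
    simpa [sub_eq_zero] using h

theorem sum_character_mul_inv [Fintype N] [DecidableEq (N →* ℂˣ)] (χ χ' : N →* ℂˣ) :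
    ∑ x : N, ((χ x⁻¹ : ℂˣ) : ℂ) * (χ' x : ℂ) = if χ = χ' then (Nat.card N : ℂ) else 0 := by
  have h := sum_hom_units ((Units.coeHom ℂ).comp (χ⁻¹ * χ' : N →* ℂˣ))
  have e : (Units.coeHom ℂ).comp (χ⁻¹ * χ' : N →* ℂˣ) = 1 ↔ χ = χ' := by
    rw [← inv_mul_eq_one (a := χ), MonoidHom.ext_iff, MonoidHom.ext_iff]
    refine forall_congr' fun x => ?_
    simp only [MonoidHom.comp_apply, Units.coeHom_apply, MonoidHom.one_apply]
    rw [Units.ext_iff, Units.val_one]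
  simp only [e] at h
  rw [Nat.card_eq_fintype_card]
  simpa [Units.coeHom_apply, MonoidHom.mul_apply] using h

end Orthogonality

/-! ### Group algebras of extensions with abelian kernel -/

section Algebra

open MonoidAlgebra

variable {G N Q : Type*} [Group G] [CommGroup N] [Finite N] [Group Q]

/-- The primitive idempotent attached to a character of a finite commutative subgroup. -/
noncomputable def characterIdempotent (ι : N →* G) (χ : N →* ℂˣ) : MonoidAlgebra ℂ G :=
  have := Fintype.ofFinite N
  (Nat.card N : ℂ)⁻¹ • ∑ x : N, ((χ x⁻¹ : ℂˣ) : ℂ) • of ℂ G (ι x)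

theorem characterIdempotent_eq [Fintype N] (ι : N →* G) (χ : N →* ℂˣ) :
    characterIdempotent ι χ = (Nat.card N : ℂ)⁻¹ • ∑ x : N, ((χ x⁻¹ : ℂˣ) : ℂ) • of ℂ G (ι x) := by
  unfold characterIdempotent
  congr!

theorem of_mul_characterIdempotent (ι : N →* G) (χ : N →* ℂˣ) (x : N) :
    of ℂ G (ι x) * characterIdempotent ι χ = (χ x : ℂ) • characterIdempotent ι χ := by
  have := Fintype.ofFinite N
  rw [characterIdempotent_eq, mul_smul_comm, smul_comm (χ x : ℂ), Finset.mul_sum]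
  congr 1
  rw [Finset.smul_sum]
  refine Fintype.sum_equiv (Equiv.mulLeft x) _ _ fun y => ?_
  simp only [Equiv.coe_mulLeft, mul_smul_comm, ← map_mul, smul_smul]
  congr 1
  norm_cast
  rw [← map_mul]
  congr 1
  simp

theorem characterIdempotent_mul [DecidableEq (N →* ℂˣ)] (ι : N →* G) (χ χ' : N →* ℂˣ) :
    characterIdempotent ι χ * characterIdempotent ι χ' =
      if χ = χ' then characterIdempotent ι χ' else 0 := by
  have := Fintype.ofFinite N
  rw [characterIdempotent_eq ι χ, smul_mul_assoc, Finset.sum_mul]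
  simp only [smul_mul_assoc, of_mul_characterIdempotent, smul_smul]
  rw [← Finset.sum_smul, sum_character_mul_inv, smul_smul]
  split_ifs <;> simp

theorem sum_characterIdempotent [Fintype (N →* ℂˣ)] (ι : N →* G) :
    ∑ χ : N →* ℂˣ, characterIdempotent ι χ = 1 := by
  classical
  have := Fintype.ofFinite N
  simp only [characterIdempotent_eq]
  rw [← Finset.smul_sum, Finset.sum_comm]
  simp only [← Finset.sum_smul, sum_character_apply]
  simp [← MonoidAlgebra.one_def]

/-- Conjugation by `g` permutes the idempotents in the way it permutes the characters; here `χ'` is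
the translate of `χ`. -/
theorem of_mul_characterIdempotent_conj (ι : N →* G) (χ χ' : N →* ℂˣ) (g : G) (α : MulAut N)
    (hα : ∀ x, g * ι x * g⁻¹ = ι (α x)) (hχ : ∀ x, χ' (α x) = χ x) :
    of ℂ G g * characterIdempotent ι χ = characterIdempotent ι χ' * of ℂ G g := by
  have := Fintype.ofFinite N
  rw [characterIdempotent_eq, characterIdempotent_eq, mul_smul_comm, smul_mul_assoc,
    Finset.mul_sum, Finset.sum_mul]
  congr 1
  refine Fintype.sum_equiv α.toEquiv _ _ fun x => ?_
  have : (α.toEquiv x : N) = α x := rfl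
  rw [this, mul_smul_comm, smul_mul_assoc, ← map_mul, ← map_mul, ← hα, ← map_inv, hχ]
  simp

/-- The algebra of functions on the dual of `N`, mapped to the group algebra of `G`. -/
noncomputable def dualFunctions [Fintype (N →* ℂˣ)] (ι : N →* G) :
    ((N →* ℂˣ) → ℂ) →ₐ[ℂ] MonoidAlgebra ℂ G :=
  AlgHom.ofLinearMap
    (∑ χ : N →* ℂˣ, (LinearMap.proj χ).smulRight (characterIdempotent ι χ))
    (by simp [sum_characterIdempotent])
    (by
      classical
      intro a b
      simp only [LinearMap.sum_apply, LinearMap.smulRight_apply, LinearMap.proj_apply,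
        Finset.sum_mul_sum, smul_mul_smul_comm, characterIdempotent_mul, smul_ite, smul_zero,
        Finset.sum_ite_eq, Finset.mem_univ, if_true, Pi.mul_apply])

theorem dualFunctions_apply [Fintype (N →* ℂˣ)] (ι : N →* G) (a : (N →* ℂˣ) → ℂ) :
    dualFunctions ι a = ∑ χ, a χ • characterIdempotent ι χ := by
  simp [dualFunctions]

/-- Fourier inversion: `ι x` acts on each idempotent by `χ x`, and the idempotents sum to 1. -/
theorem dualFunctions_eval [Fintype (N →* ℂˣ)] (ι : N →* G) (x : N) :
    dualFunctions ι (fun χ => (χ x : ℂ)) = of ℂ G (ι x) := by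
  rw [dualFunctions_apply]
  simp only [← of_mul_characterIdempotent]
  rw [← Finset.mul_sum, sum_characterIdempotent, mul_one]

theorem dualFunctions_mem_adjoin [Fintype (N →* ℂˣ)] (ι : N →* G) (a : (N →* ℂˣ) → ℂ)
    (S : Subalgebra ℂ (MonoidAlgebra ℂ G)) (hS : ∀ x, of ℂ G (ι x) ∈ S) :
    dualFunctions ι a ∈ S := by
  have := Fintype.ofFinite N
  rw [dualFunctions_apply]
  refine sum_mem fun χ _ => S.smul_mem ?_ _
  rw [characterIdempotent_eq]
  exact S.smul_mem (sum_mem fun x _ => S.smul_mem (hS x) _) _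

theorem dualFunctions_mul_of [Fintype (N →* ℂˣ)] (ι : N →* G) (a : (N →* ℂˣ) → ℂ) (g : G)
    (s : Equiv.Perm (N →* ℂˣ)) (α : MulAut N)
    (hα : ∀ x, g * ι x * g⁻¹ = ι (α x)) (hs : ∀ χ x, s χ (α x) = χ x) :
    dualFunctions ι a * of ℂ G g = of ℂ G g * dualFunctions ι (fun χ => a (s χ)) := by
  simp only [dualFunctions_apply, Finset.sum_mul, Finset.mul_sum]
  refine (Fintype.sum_equiv s _ _ fun χ => ?_).symm
  rw [mul_smul_comm, smul_mul_assoc, of_mul_characterIdempotent_conj ι χ (s χ) g α hα (hs χ)]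

/-- The action of `Q` on the characters of `N` induced by an action on `N`. -/
abbrev dualMulAction (φ : Q →* MulAut N) : MulAction Q (N →* ℂˣ) where
  smul q χ := χ.comp (φ q⁻¹ : N ≃* N).toMonoidHom
  one_smul χ := by
    ext x
    change ((χ (φ 1⁻¹ x) : ℂˣ) : ℂ) = χ x
    simp
  mul_smul q r χ := by
    ext x
    change ((χ (φ (q * r)⁻¹ x) : ℂˣ) : ℂ) = χ (φ r⁻¹ (φ q⁻¹ x))
    simp

/-- If every character of the commutative normal subgroup `N` of `G` extends to its stabilizer,
the group algebra of `G` is that of a semidirect product. -/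
theorem nonempty_algEquiv_semidirectProduct [Finite G] (p : G →* Q)
    (hp : Function.Surjective p) (ι : N →* G) (hι : Function.Injective ι)
    (hpι : ∀ g, p g = 1 ↔ g ∈ Set.range ι) (φ : Q →* MulAut N)
    (hφ : ∀ g x, g * ι x * g⁻¹ = ι (φ (p g) x))
    (hext : ∀ χ : N →* ℂˣ, ∃ f : G → ℂˣ,
      (∀ g h, (∀ x, χ (φ (p g) x) = χ x) → (∀ x, χ (φ (p h) x) = χ x) → f (g * h) = f g * f h) ∧
        ∀ x, f (ι x) = χ x) :
    Nonempty (MonoidAlgebra ℂ (N ⋊[φ] Q) ≃ₐ[ℂ] MonoidAlgebra ℂ G) := by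
  classical
  have := hasEnoughRootsOfUnity_complex (N := N)
  have : Finite (N →* ℂˣ) := inferInstance
  have := Fintype.ofFinite (N →* ℂˣ)
  have : Finite Q := Finite.of_surjective p hp
  let _ : MulAction Q (N →* ℂˣ) := dualMulAction φ
  let _ : MulAction G (N →* ℂˣ) := MulAction.compHom _ p
  have hsm : ∀ (g : G) (χ : N →* ℂˣ) x, (g • χ) x = χ (φ (p g)⁻¹ x) := fun _ _ _ => rfl
  have hsm' : ∀ (g : G) (χ : N →* ℂˣ) x, (g • χ) (φ (p g) x) = χ x := fun g χ x => by
    rw [hsm]; simp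
  have hpι1 : ∀ x, p (ι x) = 1 := fun x => (hpι _).2 ⟨x, rfl⟩
  have hιs : ∀ x (χ : N →* ℂˣ), ι x • χ = χ := fun x χ => by
    ext y; rw [hsm, hpι1]; simp
  obtain ⟨w, hw, hwι⟩ := exists_groupoid_character (G := G) (Ω := N →* ℂˣ) (A := ℂˣ) ι
    (fun χ x => χ x) hιs (fun g x => ⟨_, hφ g x⟩)
    (fun g χ x y hxy => by
      rw [hφ] at hxy
      rw [← hι hxy, hsm'])
    (fun χ => by
      obtain ⟨f, hf, hfι⟩ := hext χ
      have key : ∀ g : G, g • χ = χ → ∀ x, χ (φ (p g) x) = χ x := fun g hg x => by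
        conv_lhs => rw [← hg]
        exact hsm' g χ x
      exact ⟨f, fun g h hg hh => hf g h (key g hg) (key h hh), hfι⟩)
  let D := dualFunctions (N := N) ι
  have hDof : ∀ (a : (N →* ℂˣ) → ℂ) (g : G),
      D a * of ℂ G g = of ℂ G g * D (fun χ => a (g • χ)) := fun a g =>
    dualFunctions_mul_of ι a g (MulAction.toPerm g) (φ (p g)) (hφ g) (hsm' g)
  have hDc : ∀ a b, D a * D b = D b * D a := fun a b => by rw [← map_mul, mul_comm, map_mul]
  -- Dividing `g` by the cocycle keeps multiplicativity and makes the elements of `N` trivial, so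
  -- that `U` depends only on the image in `Q`.
  let U : G → MonoidAlgebra ℂ G := fun g => of ℂ G g * D (fun χ => ((w g χ)⁻¹ : ℂˣ))
  have hUmul : ∀ g h, U (g * h) = U g * U h := fun g h => by
    change _ = (of ℂ G g * D _) * (of ℂ G h * D _)
    rw [mul_assoc, ← mul_assoc (D _), hDof, mul_assoc, ← mul_assoc, ← map_mul, ← map_mul D]
    change of ℂ G (g * h) * D _ = _
    congr 2
    ext χ
    simp [hw, mul_comm]
  have hUι : ∀ x, U (ι x) = 1 := fun x => by
    change of ℂ G (ι x) * D _ = 1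
    rw [← dualFunctions_eval, ← map_mul, ← map_one D]
    congr 1
    ext χ
    simp [hwι]
  have hU1 : U 1 = 1 := by rw [← map_one ι, hUι]
  have hUp : ∀ g h, p g = p h → U g = U h := fun g h hgh => by
    obtain ⟨x, hx⟩ := (hpι (h⁻¹ * g)).1 (by simp [hgh])
    have : g = h * ι x := by rw [hx]; group
    rw [this, hUmul, hUι, mul_one]
  have hUconj : ∀ g x, U g * of ℂ G (ι x) = of ℂ G (ι (φ (p g) x)) * U g := fun g x => by
    have h1 : of ℂ G (ι (φ (p g) x)) * of ℂ G g = of ℂ G g * of ℂ G (ι x) := by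
      rw [← map_mul, ← map_mul, ← hφ]
      simp
    change of ℂ G g * D _ * _ = _ * (of ℂ G g * D _)
    rw [← mul_assoc, h1, mul_assoc, mul_assoc, ← dualFunctions_eval, hDc]
  -- The twist is invertible within the span of `N`; this gives surjectivity below.
  have hofU : ∀ g, of ℂ G g = U g * D (fun χ => (w g χ : ℂ)) := fun g => by
    change _ = of ℂ G g * D _ * D _
    rw [mul_assoc, ← map_mul D]
    have : (fun χ => (((w g χ)⁻¹ : ℂˣ) : ℂ)) * (fun χ => (w g χ : ℂ)) = 1 := by
      ext χ; simp
    rw [this, map_one, mul_one]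
  clear_value U
  -- A set-theoretic section suffices, because `U` does not see the choice of lift.
  choose s hs using hp
  let Ψ : N ⋊[φ] Q →* MonoidAlgebra ℂ G :=
    { toFun := fun y => of ℂ G (ι y.left) * U (s y.right)
      map_one' := by
        rw [SemidirectProduct.one_left, SemidirectProduct.one_right, map_one, map_one, one_mul,
          hUp (s 1) 1 (by rw [hs, map_one]), hU1]
      map_mul' := fun y z => by
        rw [SemidirectProduct.mul_left, SemidirectProduct.mul_right,
          hUp (s (y.right * z.right)) (s y.right * s z.right) (by simp [hs]), hUmul, map_mul,
          map_mul]
        have := hUconj (s y.right) z.left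
        rw [hs] at this
        rw [mul_assoc, ← mul_assoc _ (U _) (U _), ← this, mul_assoc, mul_assoc] }
  let Φ : MonoidAlgebra ℂ (N ⋊[φ] Q) →ₐ[ℂ] MonoidAlgebra ℂ G := MonoidAlgebra.lift ℂ _ _ Ψ
  have hΦ : ∀ y, Φ (of ℂ _ y) = of ℂ G (ι y.left) * U (s y.right) := fun y => by
    simp [Φ, Ψ]
  have hs1 : U (s 1) = 1 := by rw [hUp (s 1) 1 (by rw [hs, map_one]), hU1]
  have hrangeι : ∀ x, of ℂ G (ι x) ∈ Φ.range := fun x =>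
    ⟨of ℂ _ ⟨x, 1⟩, by
      change Φ _ = _
      rw [hΦ]
      dsimp only
      rw [hs1, mul_one]⟩
  have hrangeU : ∀ g, U g ∈ Φ.range := fun g => ⟨of ℂ _ ⟨1, p g⟩, by
      change Φ _ = _
      rw [hΦ]
      dsimp only
      rw [map_one, map_one, one_mul]
      exact hUp _ _ (hs _)⟩
  have hrange : Φ.range = ⊤ := by
    rw [eq_top_iff]
    intro y _
    induction y using MonoidAlgebra.induction_on with
    | of g =>
      rw [hofU]
      exact mul_mem (hrangeU g) (dualFunctions_mem_adjoin ι _ _ hrangeι)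
    | add x y hx hy => exact add_mem (hx trivial) (hy trivial)
    | smul r x hx => exact Φ.range.smul_mem (hx trivial) r
  have hsurj : Function.Surjective Φ := fun y => by
    have : y ∈ Φ.range := hrange ▸ trivial
    exact this
  -- Equal group orders give equal dimensions, so the surjection is an isomorphism.
  have hcard : Nat.card (N ⋊[φ] Q) = Nat.card G := by
    rw [SemidirectProduct.card, Subgroup.card_eq_card_quotient_mul_card_subgroup p.ker, mul_comm]
    congr 1
    · exact (Nat.card_congr (QuotientGroup.quotientKerEquivOfSurjective p
        (fun q => ⟨s q, hs q⟩)).toEquiv).symm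
    · refine Nat.card_congr ((Equiv.ofInjective ι hι).trans (Equiv.setCongr ?_))
      ext g
      exact (hpι g).symm
  have hfin : Finite (N ⋊[φ] Q) := Finite.of_equiv _ SemidirectProduct.equivProd.symm
  have := Fintype.ofFinite (N ⋊[φ] Q)
  have := Fintype.ofFinite G
  have hrank : Module.finrank ℂ (MonoidAlgebra ℂ (N ⋊[φ] Q)) =
      Module.finrank ℂ (MonoidAlgebra ℂ G) := by
    rw [(MonoidAlgebra.coeffLinearEquiv ℂ).finrank_eq, (MonoidAlgebra.coeffLinearEquiv ℂ).finrank_eq,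
      Module.finrank_finsupp_self, Module.finrank_finsupp_self, ← Nat.card_eq_fintype_card,
      ← Nat.card_eq_fintype_card, hcard]
  have hinj : Function.Injective Φ :=
    (LinearMap.injective_iff_surjective_of_finrank_eq_finrank (f := Φ.toLinearMap) hrank).2 hsurj
  exact ⟨AlgEquiv.ofBijective Φ ⟨hinj, hsurj⟩⟩

end Algebra

/-! ### Gluing and extending characters -/

/-- A character of a normal subgroup and a character of a subgroup that agree where both are
defined glue to the product of the two subgroups. -/
theorem exists_character_mul {G N A : Type*} [Group G] [Group N] [CommGroup A] (ι : N →* G)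
    (c : N →* A) (H : Subgroup G) (χ : H →* A)
    (hconj : ∀ h ∈ H, ∀ x, ∃ y, h * ι x * h⁻¹ = ι y ∧ c y = c x)
    (hc : ∀ x (hx : ι x ∈ H), χ ⟨ι x, hx⟩ = c x) :
    ∃ f : G → A, (∀ g g', (∃ x, ∃ h ∈ H, g = ι x * h) → (∃ x, ∃ h ∈ H, g' = ι x * h) →
      f (g * g') = f g * f g') ∧ ∀ x, f (ι x) = c x := by
  classical
  -- Two factorizations of one element differ by an element of `H` coming from `N`, where `χ` and
  -- `c` agree; hence `c x * χ h` depends on the product only.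
  have key : ∀ x (h : H) x' (h' : H), ι x * h = ι x' * h' → c x * χ h = c x' * χ h' := by
    intro x h x' h' e
    have e1 : ι (x'⁻¹ * x) = h' * (h : G)⁻¹ := by
      rw [map_mul, map_inv, eq_mul_inv_iff_mul_eq, mul_assoc, e]
      simp
    have hm : ι (x'⁻¹ * x) ∈ H := by
      rw [e1]
      exact H.mul_mem h'.2 (H.inv_mem h.2)
    have e2 := hc _ hm
    have e3 : (⟨ι (x'⁻¹ * x), hm⟩ : H) = h' * h⁻¹ := Subtype.ext e1
    rw [e3, map_mul, map_inv, map_mul, map_inv] at e2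
    have : c x = c x' * (χ h' * (χ h)⁻¹) := by rw [e2]; simp
    rw [this]
    simp [mul_assoc]
  -- The value 1 off the product of the two subgroups is arbitrary.
  let f : G → A := fun g =>
    if hg : ∃ y : N × H, g = ι y.1 * y.2 then c hg.choose.1 * χ hg.choose.2 else 1
  have hf : ∀ x (h : H), f (ι x * h) = c x * χ h := by
    intro x h
    have hg : ∃ y : N × H, ι x * h = ι y.1 * y.2 := ⟨(x, h), rfl⟩
    simp only [f, dif_pos hg]
    exact (key _ _ _ _ hg.choose_spec).symm
  refine ⟨f, ?_, fun x => ?_⟩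
  · rintro _ _ ⟨x, h, hh, rfl⟩ ⟨x', h', hh', rfl⟩
    obtain ⟨y, hy, hcy⟩ := hconj h hh x'
    have e : ι x * h * (ι x' * h') = ι (x * y) * ((⟨h, hh⟩ * ⟨h', hh'⟩ : H) : G) := by
      rw [map_mul, ← hy]
      simp only [Subgroup.coe_mul]
      group
    rw [e, hf, hf x ⟨h, hh⟩, hf x' ⟨h', hh'⟩, map_mul, map_mul, hcy]
    exact mul_mul_mul_comm _ _ _ _
  · have := hf x 1
    simpa using this

theorem exists_character_extension {N N' : Type*} [CommGroup N] [CommGroup N'] [Finite N']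
    {i : N →* N'} (hi : Function.Injective i) (c : N →* ℂˣ) : ∃ θ : N' →* ℂˣ, ∀ x, θ (i x) = c x := by
  have := hasEnoughRootsOfUnity_complex (N := N')
  let e := MonoidHom.ofInjective hi
  obtain ⟨θ, hθ⟩ := MonoidHom.domRestrict_surjective ℂ i.range (c.comp e.symm.toMonoidHom)
  refine ⟨θ, fun x => ?_⟩
  have h := DFunLike.congr_fun hθ (e x)
  rwa [MonoidHom.comp_apply, MulEquiv.coe_toMonoidHom, MulEquiv.symm_apply_apply] at h

/-! ### Square-zero extensions and the congruence subgroup -/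

/-- A ring `R` with residue field `k` whose maximal ideal is a copy of the `R`-module `k`. -/
structure SquareZeroExtension (R k : Type*) [CommRing R] [Field k] where
  /-- The residue map. -/
  res : R →+* k
  /-- The inclusion of the maximal ideal. -/
  inc : k →+ R
  res_surjective : Function.Surjective res
  inc_injective : Function.Injective inc
  inc_res_mul : ∀ r x, inc (res r * x) = r * inc x
  res_inc : ∀ x, res (inc x) = 0
  exists_inc : ∀ r, res r = 0 → ∃ x, inc x = r

namespace SquareZeroExtension

variable {R k : Type*} [CommRing R] [Field k] (E : SquareZeroExtension R k)

theorem inc_mul_inc (x y : k) : E.inc x * E.inc y = 0 := by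
  rw [← E.inc_res_mul, E.res_inc, zero_mul, map_zero]

theorem isUnit_of_res_ne_zero {r : R} (hr : E.res r ≠ 0) : IsUnit r := by
  obtain ⟨s, hs⟩ := E.res_surjective (E.res r)⁻¹
  obtain ⟨x, hx⟩ := E.exists_inc (r * s - 1) (by simp [hs, hr])
  refine IsUnit.of_mul_eq_one (s * (1 - E.inc x)) ?_
  have : r * s = 1 + E.inc x := by rw [hx]; ring
  rw [← mul_assoc, this]
  have := E.inc_mul_inc x x
  linear_combination -this

/-- The units `1 + inc x`. -/
def unitsInc : Multiplicative k →* Rˣ where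
  toFun x := ⟨1 + E.inc x.toAdd, 1 - E.inc x.toAdd,
    by linear_combination -E.inc_mul_inc x.toAdd x.toAdd,
    by linear_combination -E.inc_mul_inc x.toAdd x.toAdd⟩
  map_one' := by ext; simp
  map_mul' x y := by
    ext
    simp only [toAdd_mul, map_add, Units.val_mul]
    linear_combination -E.inc_mul_inc x.toAdd y.toAdd

theorem val_unitsInc (x : Multiplicative k) : (E.unitsInc x : R) = 1 + E.inc x.toAdd := rfl

theorem unitsInc_injective : Function.Injective E.unitsInc := fun x y h => by
  have := congrArg Units.val h
  rw [val_unitsInc, val_unitsInc, add_right_inj] at this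
  exact E.inc_injective this

variable {n : Type*}

theorem map_res_map_inc (X : Matrix n n k) : (X.map E.inc).map E.res = 0 := by
  ext i j
  simp [E.res_inc]

theorem map_inc_injective : Function.Injective fun X : Matrix n n k => X.map E.inc :=
  Matrix.map_injective E.inc_injective

theorem map_inc_add (X Y : Matrix n n k) :
    (X + Y).map E.inc = X.map E.inc + Y.map E.inc :=
  Matrix.map_add _ (map_add E.inc) X Y

variable [Fintype n]

theorem mul_map_inc (M : Matrix n n R) (X : Matrix n n k) :
    M * X.map E.inc = (M.map E.res * X).map E.inc := by
  ext i j
  simp [Matrix.mul_apply, map_sum, E.inc_res_mul]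

theorem map_inc_mul (X : Matrix n n k) (M : Matrix n n R) :
    X.map E.inc * M = (X * M.map E.res).map E.inc := by
  ext i j
  simp only [Matrix.mul_apply, map_sum, Matrix.map_apply]
  refine Finset.sum_congr rfl fun l _ => ?_
  rw [mul_comm (X i l), E.inc_res_mul, mul_comm]

theorem map_inc_mul_map_inc (X Y : Matrix n n k) : X.map E.inc * Y.map E.inc = 0 := by
  rw [mul_map_inc, map_res_map_inc, zero_mul]
  ext i j
  simp

variable [DecidableEq n]

/-- The congruence subgroup of the general linear group: the matrices `1 + inc X`. -/
def congruence : Multiplicative (Matrix n n k) →* GL n R where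
  toFun X := ⟨1 + X.toAdd.map E.inc, 1 - X.toAdd.map E.inc,
    by rw [mul_sub, add_mul, add_mul, map_inc_mul_map_inc]; simp,
    by rw [mul_add, sub_mul, sub_mul, map_inc_mul_map_inc]; simp⟩
  map_one' := by ext; simp
  map_mul' X Y := by
    apply Units.ext
    simp only [toAdd_mul, map_inc_add, Units.val_mul]
    rw [mul_add, add_mul, add_mul, map_inc_mul_map_inc]
    simp [add_assoc]

theorem val_congruence (X : Multiplicative (Matrix n n k)) :
    (E.congruence X : Matrix n n R) = 1 + X.toAdd.map E.inc := rfl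

theorem congruence_injective :
    Function.Injective (E.congruence : Multiplicative (Matrix n n k) →* GL n R) := fun X Y h => by
  have := congrArg Units.val h
  rw [val_congruence, val_congruence, add_right_inj] at this
  exact E.map_inc_injective this

/-- Reduction of invertible matrices. -/
def reduction : GL n R →* GL n k := Matrix.GeneralLinearGroup.map E.res

theorem val_reduction (g : GL n R) :
    (E.reduction g : Matrix n n k) = (g : Matrix n n R).map E.res := rfl

/-- The lift is kept entrywise for a given section `τ`, so that relations between entries of `g`
survive in it. -/
theorem exists_reduction_eq (τ : k → R) (hτ : ∀ x, E.res (τ x) = x) (g : GL n k) :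
    ∃ h : GL n R, (h : Matrix n n R) = (g : Matrix n n k).map τ ∧ E.reduction h = g := by
  have hmap : ((g : Matrix n n k).map τ).map E.res = g := by
    ext i j; simp [hτ]
  have hdet : IsUnit ((g : Matrix n n k).map τ).det := by
    refine E.isUnit_of_res_ne_zero ?_
    rw [RingHom.map_det, RingHom.mapMatrix_apply, hmap]
    exact (g.isUnit.map Matrix.detMonoidHom).ne_zero
  refine ⟨Matrix.GeneralLinearGroup.mk'' _ hdet, rfl, Units.ext ?_⟩
  rw [val_reduction]
  exact hmap

theorem reduction_surjective :
    Function.Surjective (E.reduction : GL n R →* GL n k) := fun g => by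
  obtain ⟨h, -, hh⟩ := E.exists_reduction_eq _ (Function.surjInv_eq E.res_surjective) g
  exact ⟨h, hh⟩

theorem reduction_eq_one_iff (g : GL n R) :
    E.reduction g = 1 ↔ g ∈ Set.range (E.congruence (n := n)) := by
  constructor
  · intro h
    have h' : ∀ i j, ∃ x, E.inc x = ((g : Matrix n n R) - 1) i j := fun i j => by
      refine E.exists_inc _ ?_
      have h1 : (E.reduction g).val = 1 := by rw [h]; rfl
      have := congrFun (congrFun h1 i) j
      rw [val_reduction, Matrix.map_apply] at this
      rw [Matrix.sub_apply, map_sub, this, Matrix.one_apply, Matrix.one_apply]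
      split_ifs <;> simp
    choose X hX using h'
    refine ⟨Multiplicative.ofAdd (Matrix.of X), Units.ext ?_⟩
    rw [val_congruence]
    ext i j
    simp [hX]
  · rintro ⟨X, rfl⟩
    apply Units.ext
    rw [val_reduction, val_congruence, Matrix.map_add _ (map_add E.res), map_res_map_inc]
    simp

theorem conj_congruence (g : GL n R) (X : Multiplicative (Matrix n n k)) :
    g * E.congruence X * g⁻¹ = E.congruence (Multiplicative.ofAdd
      ((E.reduction g).val * X.toAdd * (E.reduction g)⁻¹.val)) := by
  apply Units.ext
  simp only [Units.val_mul, val_congruence, mul_add, add_mul, mul_one, toAdd_ofAdd]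
  rw [mul_map_inc, map_inc_mul, ← Units.val_mul, mul_inv_cancel]
  rfl

/-- `inc X` is `inc 1` times a lift of `X`, and `inc 1` has square zero, so only the first-order
term of the determinant remains. -/
theorem det_one_add_map_inc (X : Matrix n n k) :
    (1 + X.map E.inc).det = 1 + E.inc X.trace := by
  choose τ hτ using E.res_surjective
  have h : X.map E.inc = E.inc 1 • X.map τ := by
    ext i j
    simp only [Matrix.map_apply, Matrix.smul_apply, smul_eq_mul]
    rw [mul_comm, ← E.inc_res_mul, hτ, mul_one]
  rw [h, Matrix.det_one_add_smul, sq, inc_mul_inc, mul_zero, add_zero, ← E.inc_res_mul, mul_one]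
  congr 2
  simp [Matrix.trace, hτ]

/-- The character `X ↦ ψ (tr (A X))` of the congruence subgroup extends to its stabilizer. -/
def CharacterExtends (ψ : Multiplicative k →* ℂˣ) (A : Matrix n n k) : Prop :=
  ∃ f : GL n R → ℂˣ,
    (∀ g h, Commute (E.reduction g : Matrix n n k) A → Commute (E.reduction h : Matrix n n k) A →
      f (g * h) = f g * f h) ∧
    ∀ X : Matrix n n k, f (E.congruence (Multiplicative.ofAdd X)) =
      ψ (Multiplicative.ofAdd (A * X).trace)

end SquareZeroExtension

/-! ### Jordan matrices and their centralizers -/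

section JordanMatrix

variable {n S : Type*} [Fintype n] [DecidableEq n] [CommRing S]

/-- The 0-1 matrix of a partial map. -/
def partialMapMatrix (S : Type*) [CommRing S] (σ : n → Option n) : Matrix n n S :=
  Matrix.of fun i j => if σ j = some i then 1 else 0

theorem mul_partialMapMatrix_apply (σ : n → Option n) (Z : Matrix n n S) (i j : n) :
    (Z * partialMapMatrix S σ) i j = (σ j).elim 0 (Z i) := by
  simp only [Matrix.mul_apply, partialMapMatrix, Matrix.of_apply, mul_ite, mul_one, mul_zero]
  cases h : σ j with
  | none => simp
  | some l => simp

theorem partialMapMatrix_mul_apply_of_eq {σ : n → Option n}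
    (hσ : ∀ i j l, σ i = some l → σ j = some l → i = j) (Z : Matrix n n S) {i l : n}
    (h : σ l = some i) (j : n) : (partialMapMatrix S σ * Z) i j = Z l j := by
  simp only [Matrix.mul_apply, partialMapMatrix, Matrix.of_apply, ite_mul, one_mul, zero_mul]
  rw [Finset.sum_eq_single l]
  · simp [h]
  · intro m _ hm
    rw [if_neg fun h' => hm (hσ _ _ _ h' h)]
  · simp

theorem partialMapMatrix_mul_apply_of_ne {σ : n → Option n} (Z : Matrix n n S) {i : n}
    (h : ∀ l, σ l ≠ some i) (j : n) : (partialMapMatrix S σ * Z) i j = 0 := by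
  simp [Matrix.mul_apply, partialMapMatrix, h]

/-- For a partial injection, commuting with its matrix only says that certain entries are equal and
others are zero. Any map fixing 0, additive or not, preserves this. -/
theorem commute_map_partialMapMatrix {T : Type*} [CommRing T] {σ : n → Option n}
    (hσ : ∀ i j l, σ i = some l → σ j = some l → i = j) {Z : Matrix n n S} (τ : S → T)
    (hτ : τ 0 = 0) (h : Commute Z (partialMapMatrix S σ)) :
    Commute (Z.map τ) (partialMapMatrix T σ) := by
  ext i j
  have h1 : ((Z.map τ) * partialMapMatrix T σ) i j = τ ((Z * partialMapMatrix S σ) i j) := by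
    rw [mul_partialMapMatrix_apply, mul_partialMapMatrix_apply]
    cases σ j <;> simp [hτ]
  have h2 : (partialMapMatrix T σ * (Z.map τ)) i j = τ ((partialMapMatrix S σ * Z) i j) := by
    by_cases hi : ∃ l, σ l = some i
    · obtain ⟨l, hl⟩ := hi
      rw [partialMapMatrix_mul_apply_of_eq hσ _ hl, partialMapMatrix_mul_apply_of_eq hσ _ hl]
      rfl
    · push Not at hi
      rw [partialMapMatrix_mul_apply_of_ne _ hi, partialMapMatrix_mul_apply_of_ne _ hi, hτ]
  rw [h1, h2, h.eq]

theorem isNilpotent_partialMapMatrix (σ : n → Option n) (ht : n → ℕ)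
    (hht : ∀ i j, σ j = some i → ht i = ht j + 1) : IsNilpotent (partialMapMatrix S σ) := by
  have h : ∀ m i j, (partialMapMatrix S σ ^ m) i j ≠ 0 → ht i = ht j + m := by
    intro m
    induction m with
    | zero =>
      intro i j hij
      by_cases e : i = j
      · simp [e]
      · simp [e] at hij
    | succ m ih =>
      intro i j hij
      rw [pow_succ, mul_partialMapMatrix_apply] at hij
      cases hj : σ j with
      | none => simp [hj] at hij
      | some l =>
        rw [hj] at hij
        have := ih i l hij
        have := hht l j hj
        omega
  -- A nonzero entry of the `m`-th power raises the height by `m`, and no height exceeds the sum of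
  -- all heights.
  refine ⟨(∑ i, ht i) + 1, ?_⟩
  ext i j
  by_contra hij
  have h1 := h _ _ _ hij
  have h2 : ht i ≤ ∑ i, ht i := Finset.single_le_sum (fun _ _ => Nat.zero_le _) (Finset.mem_univ i)
  omega

theorem commute_diagonal_partialMapMatrix {σ : n → Option n} {d : n → S}
    (hd : ∀ i j, σ j = some i → d i = d j) :
    Commute (Matrix.diagonal d) (partialMapMatrix S σ) := by
  ext i j
  rw [Matrix.diagonal_mul, Matrix.mul_diagonal]
  simp only [partialMapMatrix, Matrix.of_apply]
  split_ifs with h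
  · rw [hd i j h, mul_comm]
  · simp

/-- The diagonal part is a power of the sum: if `N ^ m = 0`, the exponent `|k| ^ m` is a power of
the characteristic, is at least `m` and fixes every element of `k`. -/
theorem commute_diagonal_of_commute_add {k : Type*} [Field k] [Finite k] {d : n → k}
    {N Z : Matrix n n k} (hN : IsNilpotent N) (hdN : Commute (Matrix.diagonal d) N)
    (h : Commute Z (Matrix.diagonal d + N)) : Commute Z (Matrix.diagonal d) := by
  have := Fintype.ofFinite k
  cases isEmpty_or_nonempty n
  · exact Subsingleton.elim _ _
  obtain ⟨p, hp⟩ := CharP.exists k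
  obtain ⟨f, hpp, hf⟩ := FiniteField.card k p
  have : Fact p.Prime := ⟨hpp⟩
  obtain ⟨m, hm⟩ := hN
  have hq : ∀ x : k, x ^ (p ^ ((f : ℕ) * m)) = x := fun x => by
    rw [pow_mul, ← hf]; exact FiniteField.pow_card_pow m x
  have hm' : m ≤ p ^ ((f : ℕ) * m) :=
    (Nat.le_mul_of_pos_left m f.pos).trans (Nat.lt_pow_self hpp.one_lt).le
  have key : (Matrix.diagonal d + N) ^ (p ^ ((f : ℕ) * m)) = Matrix.diagonal d := by
    rw [add_pow_char_pow_of_commute p _ hdN, pow_eq_zero_of_le hm' hm, add_zero,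
      Matrix.diagonal_pow]
    congr 1
    ext i
    exact hq _
  rw [← key]
  exact h.pow_right _

theorem apply_eq_zero_of_commute_diagonal {k : Type*} [Field k] {d : n → k} {Z : Matrix n n k}
    (h : Commute Z (Matrix.diagonal d)) {i j : n} (hij : d i ≠ d j) : Z i j = 0 := by
  have := congrFun (congrFun h.eq i) j
  rw [Matrix.diagonal_mul, Matrix.mul_diagonal] at this
  have h' : (d i - d j) * Z i j = 0 := by linear_combination -this
  exact (mul_eq_zero.mp h').resolve_left (sub_ne_zero.mpr hij)

variable (S) in
/-- The projection to the coordinates where `d` takes the value `a`. -/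
def levelProjection {k : Type*} [DecidableEq k] (d : n → k) (a : k) : Matrix n n S :=
  Matrix.diagonal fun i => if d i = a then 1 else 0

theorem levelProjection_mul_self {k : Type*} [DecidableEq k] (d : n → k) (a : k) :
    levelProjection S d a * levelProjection S d a = levelProjection S d a := by
  simp +contextual [levelProjection]

theorem commute_levelProjection {k : Type*} [DecidableEq k] {d : n → k} (a : k)
    {Z : Matrix n n S} (h : ∀ i j, d i ≠ d j → Z i j = 0) :
    Commute Z (levelProjection S d a) := by
  ext i j
  rw [levelProjection, Matrix.diagonal_mul, Matrix.mul_diagonal]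
  by_cases hij : d i = d j
  · simp [hij]
  · simp [h i j hij]

theorem apply_eq_zero_of_commute_levelProjection {k : Type*} [DecidableEq k] {d : n → k}
    {Z : Matrix n n S} (h : ∀ a, Commute Z (levelProjection S d a)) {i j : n} (hij : d i ≠ d j) :
    Z i j = 0 := by
  have := congrFun (congrFun (h (d i)).eq i) j
  rw [levelProjection, Matrix.diagonal_mul, Matrix.mul_diagonal] at this
  simpa [hij.symm] using this.symm

/-- The subgroup of invertible matrices commuting with a family of matrices. -/
def glCentralizer {ι : Type*} (M : ι → Matrix n n S) : Subgroup (GL n S) where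
  carrier := {g | ∀ i, Commute (g : Matrix n n S) (M i)}
  mul_mem' ha hb i := by
    simpa using (ha i).mul_left (hb i)
  one_mem' i := by simp
  inv_mem' {g} hg i := (hg i).units_inv_left

/-- The determinant on the image of an idempotent, for matrices commuting with it. -/
def detOnRange {P : Matrix n n S} (hP : P * P = P) {H : Subgroup (GL n S)}
    (hH : ∀ h ∈ H, Commute (h : Matrix n n S) P) : H →* Sˣ :=
  MonoidHom.toHomUnits
    -- Adding the identity on the complement of the range lets the full `n × n` determinant compute
    -- the one on the range.
    { toFun := fun h => (P * h.1.val + (1 - P)).det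
      map_one' := by simp
      map_mul' := fun g h => by
        rw [← Matrix.det_mul]
        congr 1
        have h1 := (hH g.1 g.2).eq
        have h2 := (hH h.1 h.2).eq
        have e1 : P * g.1.val * (P * h.1.val) = P * (g * h).1.val := by
          rw [← h1, mul_assoc, ← mul_assoc P P, hP, ← mul_assoc, h1, mul_assoc]
          rfl
        have e2 : P * g.1.val * (1 - P) = 0 := by
          rw [mul_sub, mul_one, mul_assoc, h1, ← mul_assoc, hP, sub_self]
        have e3 : (1 - P) * (P * h.1.val) = 0 := by
          rw [sub_mul, one_mul, ← mul_assoc, hP, sub_self]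
        have e4 : (1 - P) * (1 - P) = 1 - P := by
          rw [mul_sub, mul_one, sub_mul, one_mul, hP, sub_self, sub_zero]
        rw [add_mul, mul_add, mul_add, e1, e2, e3, e4, add_zero, zero_add] }

theorem val_detOnRange {P : Matrix n n S} (hP : P * P = P) {H : Subgroup (GL n S)}
    (hH : ∀ h ∈ H, Commute (h : Matrix n n S) P) (h : H) :
    (detOnRange hP hH h : S) = (P * h.1.val + (1 - P)).det := rfl

end JordanMatrix

/-! ### Extension of characters: the Jordan case -/

namespace SquareZeroExtension

variable {R k : Type*} [CommRing R] [Field k] (E : SquareZeroExtension R k)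
  {n : Type*} [Fintype n] [DecidableEq n]

/-- Only the residues of the entries of `M` matter when multiplied by `inc X`. -/
theorem commute_of_commute_congruence (X : Matrix n n k) {M : Matrix n n R}
    (h : Commute (E.congruence (Multiplicative.ofAdd X)).val M) : Commute X (M.map E.res) := by
  have h' := h.eq
  rw [val_congruence, add_mul, mul_add, one_mul, mul_one, add_right_inj, toAdd_ofAdd,
    map_inc_mul, mul_map_inc] at h'
  exact E.map_inc_injective h'

theorem trace_mul_eq_zero_of_isNilpotent {N X : Matrix n n k} (hN : IsNilpotent N)
    (h : Commute N X) : (N * X).trace = 0 :=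
  (Matrix.isNilpotent_trace_of_isNilpotent (h.isNilpotent_mul_right hN)).eq_zero

theorem characterExtends_jordan [Finite R] (ψ : Multiplicative k →* ℂˣ) (d : n → k)
    (σ : n → Option n) (ht : n → ℕ) (hσ : ∀ i j l, σ i = some l → σ j = some l → i = j)
    (hd : ∀ i j, σ j = some i → d i = d j) (hht : ∀ i j, σ j = some i → ht i = ht j + 1) :
    E.CharacterExtends ψ (Matrix.diagonal d + partialMapMatrix k σ) := by
  classical
  have : Finite k := Finite.of_surjective _ E.res_surjective
  have := Fintype.ofFinite k
  have hN : IsNilpotent (partialMapMatrix k σ) := isNilpotent_partialMapMatrix σ ht hht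
  have hdN := commute_diagonal_partialMapMatrix hd
  set J := Matrix.diagonal d + partialMapMatrix k σ with hJ
  -- The section must send 0 to 0, so that vanishing entries lift to vanishing entries.
  obtain ⟨τ, hτ, hτ0⟩ : ∃ τ : k → R, (∀ x, E.res (τ x) = x) ∧ τ 0 = 0 := by
    choose τ hτ using E.res_surjective
    refine ⟨fun x => if x = 0 then 0 else τ x, fun x => ?_, by simp⟩
    by_cases hx : x = 0 <;> simp [hx, hτ]
  let M : Option k → Matrix n n R := fun o => o.elim (partialMapMatrix R σ) (levelProjection R d)
  let H := glCentralizer M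
  have hHN : ∀ h ∈ H, Commute h.val (partialMapMatrix R σ) := fun h hh => hh none
  have hHP : ∀ a, ∀ h ∈ H, Commute h.val (levelProjection R d a) := fun a h hh => hh (some a)
  have hresN : (partialMapMatrix R σ).map E.res = partialMapMatrix k σ := by
    ext i j
    simp only [partialMapMatrix, Matrix.map_apply, Matrix.of_apply]
    split_ifs <;> simp
  have hresP : ∀ a, (levelProjection R d a).map E.res = levelProjection k d a := fun a => by
    ext i j
    simp only [levelProjection, Matrix.map_apply, Matrix.diagonal_apply]
    split_ifs <;> simp
  -- `θ a` extends `1 + inc x ↦ ψ (a x)` to all units of `R`; applied to the determinant on the part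
  -- with eigenvalue `a`, it contributes `a` times the trace there.
  choose θ hθ using fun a : k => exists_character_extension E.unitsInc_injective
    (ψ.comp (AddMonoidHom.toMultiplicative (AddMonoidHom.mulLeft a)))
  let χ : H →* ℂˣ := ∏ a : k, (θ a).comp (detOnRange (levelProjection_mul_self d a) (hHP a))
  have hHJ : ∀ h ∈ H, Commute (E.reduction h).val J := fun h hh => by
    have h1 : Commute (E.reduction h).val (partialMapMatrix k σ) := by
      rw [← hresN]
      have := (hHN h hh).map E.res.mapMatrix
      exact this
    refine Commute.add_right ?_ h1
    have h2 : ∀ i j, d i ≠ d j → (E.reduction h).val i j = 0 := fun i j hij => by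
      rw [val_reduction, Matrix.map_apply,
        apply_eq_zero_of_commute_levelProjection (fun a => hHP a h hh) hij, map_zero]
    ext i j
    rw [Matrix.diagonal_mul, Matrix.mul_diagonal]
    by_cases hij : d i = d j
    · rw [hij, mul_comm]
    · rw [h2 i j hij]; simp
  obtain ⟨f, hf, hfc⟩ := exists_character_mul (E.congruence (n := n))
    (ψ.comp (AddMonoidHom.toMultiplicative
      ((Matrix.traceAddMonoidHom n k).comp (AddMonoidHom.mulLeft J)))) H χ
    (fun h hh X => by
      refine ⟨_, E.conj_congruence h X, ?_⟩
      simp only [MonoidHom.comp_apply]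
      congr 1
      change Multiplicative.ofAdd (J * ((E.reduction h).val * X.toAdd * (E.reduction h)⁻¹.val)).trace
        = Multiplicative.ofAdd (J * X.toAdd).trace
      rw [← mul_assoc, ← mul_assoc, ← (hHJ h hh).eq, Matrix.trace_mul_comm, ← mul_assoc, ← mul_assoc,
        ← Units.val_mul, inv_mul_cancel, Units.val_one, one_mul])
    (fun X hX => by
      have hXN : Commute X.toAdd (partialMapMatrix k σ) := by
        rw [← hresN]
        exact E.commute_of_commute_congruence _ (hHN _ hX)
      have hXP : ∀ a, Commute X.toAdd (levelProjection k d a) := fun a => by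
        rw [← hresP]
        exact E.commute_of_commute_congruence _ (hHP a _ hX)
      have hdet : ∀ a, detOnRange (levelProjection_mul_self d a) (hHP a) ⟨E.congruence X, hX⟩ =
          E.unitsInc (Multiplicative.ofAdd (levelProjection k d a * X.toAdd).trace) := fun a => by
        apply Units.ext
        rw [val_detOnRange, val_unitsInc, toAdd_ofAdd, ← det_one_add_map_inc, ← hresP,
          ← mul_map_inc, val_congruence]
        congr 1
        noncomm_ring
      change (∏ a : k, (θ a).comp (detOnRange (levelProjection_mul_self d a) (hHP a)))
        ⟨E.congruence X, hX⟩ = ψ (Multiplicative.ofAdd (J * X.toAdd).trace)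
      rw [MonoidHom.finsetProd_apply]
      simp only [MonoidHom.comp_apply, hdet, hθ]
      rw [← map_prod]
      congr 1
      have : ∀ a : k, (AddMonoidHom.toMultiplicative (AddMonoidHom.mulLeft a))
          (Multiplicative.ofAdd (levelProjection k d a * X.toAdd).trace) =
          Multiplicative.ofAdd (a * (levelProjection k d a * X.toAdd).trace) := fun a => rfl
      simp only [this]
      -- The nilpotent part of `J` has trace zero against `X`; the diagonal part gives the sum of
      -- `a` times the trace of `X` on the level of `a`.
      rw [← ofAdd_sum, hJ, add_mul, Matrix.trace_add,
        trace_mul_eq_zero_of_isNilpotent hN hXN.symm, add_zero]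
      congr 1
      simp only [Matrix.trace, Matrix.diag, levelProjection, Matrix.diagonal_mul, Finset.mul_sum,
        ite_mul, one_mul, zero_mul, mul_ite, mul_zero]
      rw [Finset.sum_comm]
      simp)
  -- The entrywise lift of the reduction of `g` lies in `H` and differs from `g` by a congruence
  -- matrix, so the glued character is multiplicative on the whole stabilizer.
  have hdecomp : ∀ g : GL n R, Commute (E.reduction g).val J →
      ∃ X, ∃ h ∈ H, g = E.congruence X * h := fun g hg => by
    have hgD := commute_diagonal_of_commute_add hN hdN hg
    have hgN : Commute (E.reduction g).val (partialMapMatrix k σ) := by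
      have := hg.sub_right hgD
      rwa [hJ, add_sub_cancel_left] at this
    obtain ⟨h, hh, hhg⟩ := E.exists_reduction_eq τ hτ (E.reduction g)
    obtain ⟨X, hX⟩ := (E.reduction_eq_one_iff (g * h⁻¹)).1 (by rw [map_mul, map_inv, hhg]; simp)
    refine ⟨X, h, fun o => ?_, by rw [hX]; simp⟩
    rw [hh]
    cases o with
    | none => exact commute_map_partialMapMatrix hσ τ hτ0 hgN
    | some a =>
      refine commute_levelProjection a fun i j hij => ?_
      rw [Matrix.map_apply, apply_eq_zero_of_commute_diagonal hgD hij, hτ0]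
  exact ⟨f, fun g h hg hh => hf g h (hdecomp g hg) (hdecomp h hh), fun X => hfc _⟩

end SquareZeroExtension

/-! ### Jordan normal form -/

section JordanForm

universe u

open Polynomial Module

variable {L : Type u} [Field L]

theorem DFinsupp.basis_apply {ι R : Type*} {M : ι → Type*} [DecidableEq ι] [Semiring R]
    [∀ i, AddCommMonoid (M i)] [∀ i, Module R (M i)] {η : ι → Type*} (b : ∀ i, Basis (η i) R (M i))
    (i : ι) (j : η i) : DFinsupp.basis b ⟨i, j⟩ = DFinsupp.single i (b i j) := by
  classical
  apply (DFinsupp.basis b).repr.injective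
  rw [Basis.repr_self]
  ext ⟨i', j'⟩
  simp only [DFinsupp.basis, LinearEquiv.trans_apply]
  by_cases h : i' = i
  · subst h
    simp [Finsupp.single_apply]
  · simp [h, Ne.symm h]

/-- Taylor expansion at `a` shows that these powers span, and the dimension is `e`. Only the ideal
of `f` is constrained, so that `f` may be a power of an irreducible that agrees with `X - C a` up to
a unit. -/
theorem exists_basis_quotient_sub_pow (a : L) (e : ℕ) {f : L[X]}
    (hf : L[X] ∙ f = L[X] ∙ (X - C a) ^ e) :
    ∃ b : Basis (Fin e) L (L[X] ⧸ L[X] ∙ f),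
      ∀ j, b j = Submodule.Quotient.mk ((X - C a) ^ (j : ℕ)) := by
  rw [hf]
  have hcard : Fintype.card (Fin e) = finrank L (L[X] ⧸ L[X] ∙ (X - C a) ^ e) := by
    have := finrank_quotient_span_eq_natDegree (f := (X - C a) ^ e)
    rw [natDegree_pow, natDegree_X_sub_C, mul_one] at this
    rw [Fintype.card_fin]
    exact this.symm
  refine ⟨basisOfTopLeSpanOfCardEqFinrank
    (fun j : Fin e => Submodule.Quotient.mk ((X - C a) ^ (j : ℕ))) ?_ hcard, fun j => by simp⟩
  rintro x -
  obtain ⟨g, rfl⟩ := Submodule.Quotient.mk_surjective _ x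
  rw [← sum_taylor_eq g a, Polynomial.sum_def]
  rw [← Submodule.mkQ_apply, map_sum]
  refine sum_mem fun i _ => ?_
  rw [Submodule.mkQ_apply, ← smul_eq_C_mul, Submodule.Quotient.mk_smul]
  refine Submodule.smul_mem _ _ ?_
  by_cases hi : i < e
  · exact Submodule.subset_span ⟨⟨i, hi⟩, rfl⟩
  · have : (Submodule.Quotient.mk ((X - C a) ^ i) : L[X] ⧸ L[X] ∙ (X - C a) ^ e) = 0 := by
      rw [Submodule.Quotient.mk_eq_zero, Submodule.mem_span_singleton]
      exact ⟨(X - C a) ^ (i - e), by rw [smul_eq_mul, ← pow_add]; congr 1; omega⟩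
    rw [this]
    exact zero_mem _

theorem exists_span_eq_span_sub_pow {p q : L[X]} (hp : Irreducible p) (hq : q.Splits)
    (hq0 : q ≠ 0) (e : ℕ) (h : p ^ e ∣ q) : ∃ a : L, L[X] ∙ p ^ e = L[X] ∙ (X - C a) ^ e := by
  -- For `e = 0` nothing forces `p` to be linear, but both ideals are the whole ring and any `a`
  -- serves.
  rcases Nat.eq_zero_or_pos e with rfl | he
  · exact ⟨0, by simp⟩
  have hps : p.Splits := hq.of_dvd hq0 ((dvd_pow_self p he.ne').trans h)
  have hdeg := hps.degree_eq_one_of_irreducible hp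
  obtain ⟨a, ha⟩ := exists_root_of_degree_eq_one hdeg
  refine ⟨a, ?_⟩
  have hassoc : Associated (X - C a) p :=
    (irreducible_X_sub_C a).associated_of_dvd hp (dvd_iff_isRoot.mpr ha)
  exact (Ideal.span_singleton_eq_span_singleton.mpr (hassoc.pow_pow (n := e))).symm

open DirectSum in
/-- A Jordan basis of an endomorphism whose characteristic polynomial splits. -/
theorem exists_jordan_basis {V : Type*} [AddCommGroup V] [Module L V] [FiniteDimensional L V]
    (A : End L V) (hA : A.charpoly.Splits) :
    ∃ (κ : Type u) (_ : Fintype κ) (b : Basis κ L V) (d : κ → L) (σ : κ → Option κ) (ht : κ → ℕ),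
      (∀ i j l, σ i = some l → σ j = some l → i = j) ∧ (∀ i j, σ j = some i → d i = d j) ∧
      (∀ i j, σ j = some i → ht i = ht j + 1) ∧
      ∀ j, A (b j) = d j • b j + (σ j).elim 0 b := by
  classical
  have hT : Module.IsTorsion L[X] (AEval' A) := AEval.isTorsion_of_finiteDimensional L V A
  obtain ⟨ι, _, p, hp, e, ⟨Φ⟩⟩ := Module.equiv_directSum_of_isTorsion hT
  -- By Cayley–Hamilton the characteristic polynomial kills every cyclic summand, so each `p i ^ e
  -- i` divides it and each block with `e i > 0` has a linear `p i`.
  have hann : ∀ x : ⨁ i, L[X] ⧸ L[X] ∙ p i ^ e i, A.charpoly • x = 0 := fun x => by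
    obtain ⟨y, rfl⟩ := Φ.surjective x
    obtain ⟨v, rfl⟩ := (AEval'.of A).surjective y
    rw [← map_smul, ← AEval.of_aeval_smul, LinearMap.aeval_self_charpoly]
    simp
  have hdvd : ∀ i, p i ^ e i ∣ A.charpoly := fun i => by
    have h := hann (DirectSum.lof L[X] ι (fun i => L[X] ⧸ L[X] ∙ p i ^ e i) i
      (Submodule.Quotient.mk 1))
    rw [← map_smul, ← map_zero (DirectSum.lof L[X] ι (fun i => L[X] ⧸ L[X] ∙ p i ^ e i) i)] at h
    have h' := DirectSum.of_injective i h
    rw [← Submodule.Quotient.mk_smul, smul_eq_mul, mul_one, Submodule.Quotient.mk_eq_zero] at h'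
    exact Ideal.mem_span_singleton.mp h'
  choose a ha using fun i => exists_span_eq_span_sub_pow (hp i) hA A.charpoly_monic.ne_zero (e i)
    (hdvd i)
  choose β hβ using fun i => exists_basis_quotient_sub_pow (a i) (e i) (ha i)
  let B : Basis (Σ i, Fin (e i)) L (⨁ i, L[X] ⧸ L[X] ∙ p i ^ e i) := DFinsupp.basis β
  have hB : ∀ i j, B ⟨i, j⟩ = DirectSum.lof L[X] ι (fun i => L[X] ⧸ L[X] ∙ p i ^ e i) i
      (Submodule.Quotient.mk ((X - C (a i)) ^ (j : ℕ))) := fun i j => by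
    rw [← hβ]
    exact DFinsupp.basis_apply β i j
  let Θ : V ≃ₗ[L] ⨁ i, L[X] ⧸ L[X] ∙ p i ^ e i := (AEval'.of A).trans (Φ.restrictScalars L)
  have hΘ : ∀ v, Θ (A v) = (X : L[X]) • Θ v := fun v => by
    change Φ (AEval'.of A (A v)) = X • Φ (AEval'.of A v)
    rw [← AEval'.X_smul_of, map_smul]
  -- Within a block the basis consists of the powers of `X - a`: `σ` raises the exponent by one
  -- while it stays below `e`, and the height is the exponent.
  refine ⟨Σ i, Fin (e i), inferInstance, B.map Θ.symm, fun x => a x.1,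
    fun x => if h : x.2 + 1 < e x.1 then some ⟨x.1, ⟨x.2 + 1, h⟩⟩ else none, fun x => x.2,
    ?_, ?_, ?_, ?_⟩
  · rintro ⟨i, i'⟩ ⟨j, j'⟩ ⟨l, l'⟩ h1 h2
    dsimp only at h1 h2
    split_ifs at h1 with h3
    split_ifs at h2 with h4
    cases h1
    have h5 := Option.some.inj h2
    rw [Sigma.mk.injEq] at h5
    obtain ⟨rfl, h5⟩ := h5
    have := congrArg Fin.val (eq_of_heq h5)
    simp only at this
    exact Sigma.ext rfl (heq_of_eq (Fin.ext (by dsimp only; omega)))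
  · rintro ⟨i, i'⟩ ⟨j, j'⟩ h
    dsimp only at h
    split_ifs at h with h1
    cases h
    rfl
  · rintro ⟨i, i'⟩ ⟨j, j'⟩ h
    dsimp only at h
    split_ifs at h with h1
    cases h
    rfl
  · rintro ⟨i, j⟩
    apply Θ.injective
    rw [hΘ, Basis.map_apply, LinearEquiv.apply_symm_apply, map_add, map_smul,
      LinearEquiv.apply_symm_apply]
    have h1 : (X : L[X]) • B ⟨i, j⟩ = a i • B ⟨i, j⟩ +
        DirectSum.lof L[X] ι (fun i => L[X] ⧸ L[X] ∙ p i ^ e i) i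
          (Submodule.Quotient.mk ((X - C (a i)) ^ ((j : ℕ) + 1))) := by
      have h2 : a i • B ⟨i, j⟩ = (C (a i) : L[X]) • B ⟨i, j⟩ := by
        rw [← algebraMap_smul L[X]]; rfl
      rw [h2, hB, ← map_smul, ← map_smul, ← map_add, ← Submodule.Quotient.mk_smul,
        ← Submodule.Quotient.mk_smul, ← Submodule.Quotient.mk_add]
      congr 2
      simp only [smul_eq_mul]
      ring
    rw [h1]
    congr 1
    dsimp only
    split_ifs with h3
    · rw [Option.elim_some, Basis.map_apply, LinearEquiv.apply_symm_apply, hB]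
    · have h4 : (j : ℕ) + 1 = e i := by omega
      have h5 : (Submodule.Quotient.mk ((X - C (a i)) ^ e i) : L[X] ⧸ L[X] ∙ p i ^ e i) = 0 := by
        rw [Submodule.Quotient.mk_eq_zero, ha i]
        exact Submodule.mem_span_singleton_self _
      rw [Option.elim_none, map_zero, h4, h5, map_zero]

/-- A matrix whose characteristic polynomial splits is conjugate to a Jordan matrix. -/
theorem exists_jordan_form {n : Type*} [Fintype n] [DecidableEq n] (A : Matrix n n L)
    (hA : A.charpoly.Splits) :
    ∃ (P : GL n L) (d : n → L) (σ : n → Option n) (ht : n → ℕ),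
      (∀ i j l, σ i = some l → σ j = some l → i = j) ∧ (∀ i j, σ j = some i → d i = d j) ∧
      (∀ i j, σ j = some i → ht i = ht j + 1) ∧
      A * P.val = P.val * (Matrix.diagonal d + partialMapMatrix L σ) := by
  obtain ⟨κ, _, b, d, σ, ht, h1, h2, h3, h4⟩ := exists_jordan_basis (Matrix.toLin' A)
    (by rwa [Matrix.charpoly_toLin'])
  let ε : κ ≃ n := b.indexEquiv (Pi.basisFun L n)
  let b' := b.reindex ε
  refine ⟨⟨(Pi.basisFun L n).toMatrix b', b'.toMatrix (Pi.basisFun L n),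
    Basis.toMatrix_mul_toMatrix_flip _ _, Basis.toMatrix_mul_toMatrix_flip _ _⟩,
    d ∘ ε.symm, fun i => (σ (ε.symm i)).map ε, ht ∘ ε.symm, ?_, ?_, ?_, ?_⟩
  · intro i j l hi hj
    rw [Option.map_eq_some_iff] at hi hj
    obtain ⟨x, hx, hx'⟩ := hi
    obtain ⟨y, hy, hy'⟩ := hj
    have : x = y := ε.injective (hx'.trans hy'.symm)
    subst this
    exact ε.symm.injective (h1 _ _ _ hx hy)
  · intro i j hj
    rw [Option.map_eq_some_iff] at hj
    obtain ⟨x, hx, rfl⟩ := hj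
    simpa using h2 _ _ hx
  · intro i j hj
    rw [Option.map_eq_some_iff] at hj
    obtain ⟨x, hx, rfl⟩ := hj
    simpa using h3 _ _ hx
  · ext i j
    have h := congrFun (h4 (ε.symm j)) i
    rw [Matrix.toLin'_apply] at h
    rw [mul_add, Matrix.add_apply, mul_partialMapMatrix_apply, Matrix.mul_diagonal]
    have e1 : ∀ i j, (Pi.basisFun L n).toMatrix b' i j = b (ε.symm j) i := fun i j => by
      simp [Basis.toMatrix_apply, b']
    rw [Matrix.mul_apply]
    simp only [e1]
    rw [Matrix.mulVec, dotProduct] at h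
    rw [h]
    cases hσ : σ (ε.symm j) <;> simp [e1, mul_comm]

end JordanForm

/-! ### Enlarging the residue field; extension of characters in general -/

namespace SquareZeroExtension

universe u v

/-- A square-zero extension from a generator of the kernel of the residue map. -/
noncomputable def ofGenerator {R k : Type*} [CommRing R] [Field k] (res : R →+* k)
    (hres : Function.Surjective res) (π : R) (hπ : ∀ r, res r = 0 ↔ r * π = 0)
    (hdvd : ∀ r, res r = 0 ↔ π ∣ r) : SquareZeroExtension R k :=
  -- Hence `inc x`, a lift of `x` times `π`, does not depend on the lift.
  have key : ∀ r s, res r = res s → r * π = s * π := fun r s h => by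
    rw [← sub_eq_zero, ← sub_mul, ← hπ, map_sub, h, sub_self]
  { res := res
    inc := AddMonoidHom.mk' (fun x => Function.surjInv hres x * π) fun x y => by
      rw [← add_mul]
      exact key _ _ (by simp [Function.surjInv_eq])
    res_surjective := hres
    inc_injective := by
      rw [injective_iff_map_eq_zero]
      intro x hx
      have := (hπ _).2 hx
      rwa [Function.surjInv_eq hres] at this
    inc_res_mul := fun r x => by
      change _ * π = r * (_ * π)
      rw [← mul_assoc]
      exact key _ _ (by simp [Function.surjInv_eq])
    res_inc := fun x => by
      change res (_ * π) = 0
      rw [map_mul, (hdvd π).2 dvd_rfl, mul_zero]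
    exists_inc := fun r hr => by
      obtain ⟨s, rfl⟩ := (hdvd r).1 hr
      refine ⟨res s, ?_⟩
      change _ * π = π * s
      rw [mul_comm π]
      exact key _ _ (by simp [Function.surjInv_eq]) }

theorem ofGenerator_inc {R k : Type*} [CommRing R] [Field k] (res : R →+* k)
    (hres : Function.Surjective res) (π : R) (hπ : ∀ r, res r = 0 ↔ r * π = 0)
    (hdvd : ∀ r, res r = 0 ↔ π ∣ r) (r : R) :
    (ofGenerator res hres π hπ hdvd).inc (res r) = r * π := by
  have h := (ofGenerator res hres π hπ hdvd).inc_res_mul r 1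
  rw [mul_one] at h
  refine h.trans ?_
  change r * (_ * π) = r * π
  congr 1
  rw [← sub_eq_zero, ← sub_one_mul, ← hπ]
  simp [Function.surjInv_eq]

open Polynomial IntermediateField in
/-- The residue field can be enlarged so that a given polynomial splits. -/
theorem exists_splitting_extension {R : Type u} {k : Type v} [CommRing R] [Finite R] [Field k]
    (E : SquareZeroExtension R k) (q : k[X]) :
    ∃ (R' : Type u) (_ : CommRing R') (_ : Finite R') (L : Type v) (_ : Field L)
      (E' : SquareZeroExtension R' L) (α : R →+* R') (β : k →+* L),
      (∀ r, E'.res (α r) = β (E.res r)) ∧ (∀ x, E'.inc (β x) = α (E.inc x)) ∧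
        (q.map β).Splits := by
  have : Finite k := Finite.of_surjective _ E.res_surjective
  let L := q.SplittingField
  have : Finite L := Module.finite_of_finite k
  obtain ⟨a, ha⟩ := Field.exists_primitive_element k L
  have hint : IsIntegral k a := Algebra.IsIntegral.isIntegral a
  -- The larger ring adjoins a root of a monic lift of the minimal polynomial of a primitive
  -- element; `inc 1` still generates the kernel of reduction.
  obtain ⟨f, hf, hfdeg, hfm⟩ := lifts_and_degree_eq_and_monic
    (f := E.res) (p := minpoly k a) ((mem_lifts _).2 (map_surjective _ E.res_surjective _))
    (minpoly.monic hint)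
  have hroot : eval₂ ((algebraMap k L).comp E.res) a f = 0 := by
    rw [← eval₂_map, hf]
    exact minpoly.aeval k a
  let R' := AdjoinRoot f
  have hfin : Finite R' := by
    have := hfm.finite_adjoinRoot
    exact Module.finite_of_finite R
  let res' : R' →+* L := AdjoinRoot.lift ((algebraMap k L).comp E.res) a hroot
  have hres' : ∀ g : R[X], res' (AdjoinRoot.mk f g) = aeval a (g.map E.res) := fun g => by
    rw [aeval_def, eval₂_map]
    exact AdjoinRoot.lift_mk hroot g
  have hsurj : Function.Surjective res' := fun l => by
    have hl : l ∈ Algebra.adjoin k {a} := by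
      rw [← adjoin_simple_toSubalgebra_of_isAlgebraic hint.isAlgebraic, ha]
      trivial
    obtain ⟨g, hg⟩ := (Algebra.adjoin_singleton_eq_range_aeval k a ▸ hl)
    obtain ⟨g', rfl⟩ := map_surjective _ E.res_surjective g
    exact ⟨AdjoinRoot.mk f g', (hres' g').trans hg⟩
  have hrepr : ∀ r : R', ∃ g : R[X], g.degree < f.degree ∧ AdjoinRoot.mk f g = r := fun r => by
    obtain ⟨g, rfl⟩ := AdjoinRoot.mk_surjective r
    have := E.res.domain_nontrivial
    refine ⟨g %ₘ f, degree_modByMonic_lt g hfm, ?_⟩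
    rw [AdjoinRoot.mk_eq_mk]
    exact ⟨-(g /ₘ f), by linear_combination modByMonic_add_div g f⟩
  let π : R' := AdjoinRoot.mk f (C (E.inc 1))
  have hπ2 : π * π = 0 := by
    rw [← map_mul, ← C_mul, inc_mul_inc, C_0, map_zero]
  -- On representatives of degree below that of `f`, vanishing in `L` means vanishing of all
  -- residues of coefficients; both descriptions of the kernel rest on this.
  have hcoeff : ∀ g : R[X], g.degree < f.degree → res' (AdjoinRoot.mk f g) = 0 →
      g.map E.res = 0 := fun g hg h => by
    rw [hres'] at h
    refine eq_zero_of_dvd_of_degree_lt (minpoly.dvd k a h) ?_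
    rw [← hfdeg]
    exact degree_map_le.trans_lt hg
  have hresπ : res' π = 0 := by
    rw [hres', map_C, E.res_inc]
    simp
  have hdvd : ∀ r, res' r = 0 ↔ π ∣ r := by
    refine fun r => ⟨fun h => ?_, fun ⟨s, hs⟩ => by rw [hs, map_mul, hresπ, zero_mul]⟩
    obtain ⟨g, hg, rfl⟩ := hrepr r
    refine map_dvd _ ?_
    rw [C_dvd_iff_dvd_coeff]
    intro i
    have h0 := congrArg (fun p => coeff p i) (hcoeff g hg h)
    simp only [coeff_map, coeff_zero] at h0
    obtain ⟨x, hx⟩ := E.exists_inc _ h0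
    obtain ⟨s, rfl⟩ := E.res_surjective x
    exact ⟨s, by rw [← hx, mul_comm, ← E.inc_res_mul, mul_one]⟩
  have hann : ∀ r, res' r = 0 ↔ r * π = 0 := by
    refine fun r => ⟨fun h => ?_, fun h => ?_⟩
    · obtain ⟨s, rfl⟩ := (hdvd r).1 h
      rw [mul_right_comm, hπ2, zero_mul]
    · obtain ⟨g, hg, rfl⟩ := hrepr r
      rw [← map_mul, AdjoinRoot.mk_eq_zero] at h
      have hz : g * C (E.inc 1) = 0 := by
        by_contra hne
        refine hfm.not_dvd_of_degree_lt hne ?_ h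
        exact (degree_mul_le _ _).trans_lt ((add_le_of_nonpos_right degree_C_le).trans_lt hg)
      rw [hres']
      have : g.map E.res = 0 := by
        ext i
        have h1 := congrArg (fun p => coeff p i) hz
        simp only [coeff_mul_C, coeff_zero] at h1
        rw [← E.inc_res_mul, mul_one] at h1
        rw [coeff_map, coeff_zero]
        exact E.inc_injective (h1.trans (map_zero _).symm)
      rw [this, map_zero]
  refine ⟨R', inferInstance, hfin, L, inferInstance, ofGenerator res' hsurj π hann hdvd,
    AdjoinRoot.of f, algebraMap k L, fun r => ?_, fun x => ?_, SplittingField.splits q⟩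
  · exact AdjoinRoot.lift_of hroot
  · obtain ⟨r, rfl⟩ := E.res_surjective x
    have h1 : algebraMap k L (E.res r) = res' (AdjoinRoot.of f r) := (AdjoinRoot.lift_of hroot).symm
    rw [h1, ofGenerator_inc]
    have h2 : E.inc (E.res r) = r * E.inc 1 := by rw [← E.inc_res_mul, mul_one]
    rw [h2, map_mul]
    rfl

variable {R k : Type*} [CommRing R] [Finite R] [Field k] (E : SquareZeroExtension R k)
  {n : Type*} [Fintype n] [DecidableEq n]

theorem characterExtends (ψ : Multiplicative k →* ℂˣ) (A : Matrix n n k) :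
    E.CharacterExtends ψ A := by
  obtain ⟨R', _, _, L, _, E', α, β, hres, hinc, hsplit⟩ := E.exists_splitting_extension A.charpoly
  have : Finite L := Finite.of_surjective _ E'.res_surjective
  -- An extension of `ψ` to the larger field makes the character of `A.map β` restrict to that of
  -- `A`, so an extension found there can be pulled back to `GL n R`.
  obtain ⟨ψ', hψ'⟩ := exists_character_extension (N' := Multiplicative L)
    (i := AddMonoidHom.toMultiplicative β.toAddMonoidHom) β.injective ψ
  rw [← Matrix.charpoly_map] at hsplit
  obtain ⟨P, d, σ, ht, h1, h2, h3, hP⟩ := exists_jordan_form (A.map β) hsplit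
  obtain ⟨f, hf, hfc⟩ := E'.characterExtends_jordan ψ' d σ ht h1 h2 h3
  set J := Matrix.diagonal d + partialMapMatrix L σ
  obtain ⟨Q, hQ⟩ := E'.reduction_surjective P
  have hmap : ∀ g : GL n R, (E'.reduction (Matrix.GeneralLinearGroup.map α g)).val =
      (E.reduction g).val.map β := fun g => by
    ext i j
    exact hres _
  have hcomm : ∀ g : GL n R, Commute (E.reduction g).val A →
      Commute (E'.reduction (Q⁻¹ * Matrix.GeneralLinearGroup.map α g * Q)).val J := fun g hg => by
    have hg' : Commute ((E.reduction g).val.map β) (A.map β) := hg.map β.mapMatrix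
    have hJ : J = P⁻¹.val * (A.map β * P.val) := by
      rw [hP, ← mul_assoc, ← Units.val_mul, inv_mul_cancel, Units.val_one, one_mul]
    rw [map_mul, map_mul, map_inv, hQ, Units.val_mul, Units.val_mul, hmap, hJ]
    have e : P.val * P⁻¹.val = 1 := by rw [← Units.val_mul, mul_inv_cancel, Units.val_one]
    have h4 := hg'.eq
    generalize (E.reduction g).val.map β = Z at *
    generalize A.map β = B at *
    calc P⁻¹.val * Z * P.val * (P⁻¹.val * (B * P.val))
        = P⁻¹.val * Z * (P.val * P⁻¹.val) * B * P.val := by simp only [mul_assoc]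
      _ = P⁻¹.val * (Z * B) * P.val := by rw [e]; simp only [mul_assoc, one_mul]
      _ = P⁻¹.val * B * (P.val * P⁻¹.val) * Z * P.val := by
        rw [h4, e]; simp only [mul_assoc, one_mul]
      _ = P⁻¹.val * (B * P.val) * (P⁻¹.val * Z * P.val) := by simp only [mul_assoc]
  -- `Q` lifts the matrix conjugating `A` into Jordan form, so this conjugate carries the stabilizer
  -- for `A` into that for `J`.
  refine ⟨fun g => f (Q⁻¹ * Matrix.GeneralLinearGroup.map α g * Q), fun g h hg hh => ?_,
    fun X => ?_⟩
  · dsimp only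
    rw [← hf _ _ (hcomm g hg) (hcomm h hh), map_mul]
    congr 1
    group
  · have hc : Matrix.GeneralLinearGroup.map α (E.congruence (Multiplicative.ofAdd X)) =
        E'.congruence (Multiplicative.ofAdd (X.map β)) := by
      ext i j
      have e : E'.inc (X.map β i j) = α (E.inc (X i j)) := hinc _
      simp only [Matrix.GeneralLinearGroup.map_apply, val_congruence, toAdd_ofAdd,
        Matrix.add_apply, map_add, Matrix.map_apply] at e ⊢
      rw [e, Matrix.one_apply, Matrix.one_apply]
      split_ifs <;> simp
    have hconj := E'.conj_congruence Q⁻¹ (Multiplicative.ofAdd (X.map β))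
    rw [inv_inv] at hconj
    dsimp only
    rw [hc, hconj, hfc, map_inv, hQ, inv_inv, toAdd_ofAdd]
    have ht : (J * (P⁻¹.val * X.map β * P.val)).trace = β (A * X).trace := by
      rw [← mul_assoc, Matrix.trace_mul_comm, ← mul_assoc, ← mul_assoc, ← hP, mul_assoc (A.map β),
        ← Units.val_mul, mul_inv_cancel, Units.val_one, mul_one, ← Matrix.map_mul]
      exact (AddMonoidHom.map_trace β.toAddMonoidHom _).symm
    rw [ht]
    exact hψ' _

end SquareZeroExtension

/-! ### Characters of the additive group of matrices -/

section TraceForm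

variable {k n : Type*} [Field k] [Fintype n]

/-- The character `X ↦ ψ (tr (A X))` of the additive group of matrices. -/
def traceCharacter (ψ : Multiplicative k →* ℂˣ) (A : Matrix n n k) :
    Multiplicative (Matrix n n k) →* ℂˣ :=
  ψ.comp (AddMonoidHom.toMultiplicative
    ((Matrix.traceAddMonoidHom n k).comp (AddMonoidHom.mulLeft A)))

theorem traceCharacter_apply (ψ : Multiplicative k →* ℂˣ) (A X : Matrix n n k) :
    traceCharacter ψ A (Multiplicative.ofAdd X) = ψ (Multiplicative.ofAdd (A * X).trace) := rfl

variable [DecidableEq n]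

theorem traceCharacter_injective {ψ : Multiplicative k →* ℂˣ} (hψ : ψ ≠ 1) :
    Function.Injective (traceCharacter (n := n) ψ) := by
  intro A B h
  rw [← sub_eq_zero]
  ext i j
  by_contra hne
  refine hψ (MonoidHom.ext fun c => ?_)
  -- Against this multiple of a matrix unit, `A - B` has trace `c`, so a nonzero entry would make
  -- `ψ` trivial.
  have h1 := DFunLike.congr_fun h (Multiplicative.ofAdd
    (Matrix.single j i (((A - B) i j)⁻¹ * c.toAdd)))
  rw [traceCharacter_apply, traceCharacter_apply, ← div_eq_one, ← map_div, ← ofAdd_sub,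
    ← Matrix.trace_sub, ← sub_mul, Matrix.trace_mul_single, op_smul_eq_mul,
    ← mul_assoc] at h1
  rw [Matrix.zero_apply] at hne
  rwa [mul_inv_cancel₀ hne, one_mul] at h1

theorem traceCharacter_surjective [Finite k] {ψ : Multiplicative k →* ℂˣ} (hψ : ψ ≠ 1) :
    Function.Surjective (traceCharacter (n := n) ψ) := by
  have := hasEnoughRootsOfUnity_complex (N := Multiplicative (Matrix n n k))
  refine ((Nat.bijective_iff_injective_and_card _).2 ⟨traceCharacter_injective hψ, ?_⟩).2
  rw [CommGroup.card_monoidHom_of_hasEnoughRootsOfUnity]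
  rfl

/-- The conjugation action of invertible matrices on the additive group of matrices. -/
def conjMulAut : GL n k →* MulAut (Multiplicative (Matrix n n k)) where
  toFun g := AddEquiv.toMultiplicative
    { toFun := fun X => g.val * X * g⁻¹.val
      invFun := fun X => g⁻¹.val * X * g.val
      left_inv := fun X => by simp [mul_assoc]
      right_inv := fun X => by simp [mul_assoc]
      map_add' := fun X Y => by rw [mul_add, add_mul] }
  map_one' := by
    refine MulEquiv.ext fun X => ?_
    change Multiplicative.ofAdd ((1 : GL n k).val * X.toAdd * (1 : GL n k)⁻¹.val) = X
    simp
  map_mul' g h := by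
    refine MulEquiv.ext fun X => ?_
    change Multiplicative.ofAdd ((g * h).val * X.toAdd * (g * h)⁻¹.val) =
      Multiplicative.ofAdd (g.val * (h.val * X.toAdd * h⁻¹.val) * g⁻¹.val)
    rw [mul_inv_rev, Units.val_mul, Units.val_mul]
    simp only [mul_assoc]

theorem conjMulAut_apply (g : GL n k) (X : Multiplicative (Matrix n n k)) :
    conjMulAut g X = Multiplicative.ofAdd (g.val * X.toAdd * g⁻¹.val) := rfl

/-- By cyclicity of the trace, conjugating `X` amounts to conjugating `A` inversely; a stabilizing
`g` therefore centralizes `A`. -/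
theorem commute_of_traceCharacter_conj {ψ : Multiplicative k →* ℂˣ} (hψ : ψ ≠ 1)
    {A : Matrix n n k} {g : GL n k}
    (h : ∀ X, traceCharacter ψ A (conjMulAut g X) = traceCharacter ψ A X) :
    Commute g.val A := by
  have h1 : g⁻¹.val * A * g.val = A := by
    refine traceCharacter_injective hψ (MonoidHom.ext fun X => ?_)
    rw [← h X, conjMulAut_apply, traceCharacter_apply, ← ofAdd_toAdd X, traceCharacter_apply,
      ofAdd_toAdd]
    congr 2
    rw [mul_assoc, mul_assoc, Matrix.trace_mul_comm]
    simp only [mul_assoc]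
  have h2 : g.val * (g⁻¹.val * A * g.val) = A * g.val := by
    rw [← mul_assoc, ← mul_assoc, ← Units.val_mul, mul_inv_cancel, Units.val_one, one_mul]
  rw [h1] at h2
  exact h2

end TraceForm

/-! ### Comparison with the semidirect product and conclusion -/

namespace SquareZeroExtension

/-- The group algebra of `GL n R` only depends on the residue field. -/
theorem nonempty_algEquiv_gl {R k : Type*} [CommRing R] [Finite R] [Field k]
    (E : SquareZeroExtension R k) (n : Type*) [Fintype n] [DecidableEq n] :
    Nonempty (MonoidAlgebra ℂ (Multiplicative (Matrix n n k) ⋊[conjMulAut] GL n k) ≃ₐ[ℂ]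
      MonoidAlgebra ℂ (GL n R)) := by
  have : Finite k := Finite.of_surjective _ E.res_surjective
  have : Finite (GL n R) := inferInstanceAs (Finite (Matrix n n R)ˣ)
  obtain ⟨ψ, hψ⟩ : ∃ ψ : Multiplicative k →* ℂˣ, ψ ≠ 1 := by
    have := hasEnoughRootsOfUnity_complex (N := Multiplicative k)
    obtain ⟨ψ, hψ⟩ := CommGroup.exists_apply_ne_one_of_hasEnoughRootsOfUnity (Multiplicative k) ℂ
      (a := Multiplicative.ofAdd 1) (by simp)
    exact ⟨ψ, fun h => hψ (by rw [h]; rfl)⟩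
  refine nonempty_algEquiv_semidirectProduct E.reduction E.reduction_surjective E.congruence
    E.congruence_injective E.reduction_eq_one_iff conjMulAut E.conj_congruence fun χ => ?_
  obtain ⟨A, rfl⟩ := traceCharacter_surjective hψ χ
  obtain ⟨f, hf, hfc⟩ := E.characterExtends ψ A
  exact ⟨f, fun g h hg hh => hf g h (commute_of_traceCharacter_conj hψ hg)
    (commute_of_traceCharacter_conj hψ hh), fun X => hfc X.toAdd⟩

/-- Transport along an isomorphism of residue fields. -/
def congrResidue {R k k' : Type*} [CommRing R] [Field k] [Field k']
    (E : SquareZeroExtension R k) (e : k ≃+* k') : SquareZeroExtension R k' where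
  res := (e : k →+* k').comp E.res
  inc := E.inc.comp (e.symm : k' →+ k)
  res_surjective := e.surjective.comp E.res_surjective
  inc_injective := E.inc_injective.comp e.symm.injective
  inc_res_mul r x := by simp [E.inc_res_mul]
  res_inc x := by simp [E.res_inc]
  exists_inc r hr := by
    obtain ⟨x, hx⟩ := E.exists_inc r (by simpa using hr)
    exact ⟨e x, by simpa using hx⟩

open IsLocalRing in
/-- The quotient of a discrete valuation ring by the square of its maximal ideal. -/
theorem nonempty_of_isDiscreteValuationRing (A : Type*) [CommRing A] [IsDomain A]
    [IsDiscreteValuationRing A] :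
    Nonempty (SquareZeroExtension (A ⧸ maximalIdeal A ^ 2) (ResidueField A)) := by
  obtain ⟨ϖ, hϖ⟩ := IsDiscreteValuationRing.exists_irreducible A
  have hm : maximalIdeal A = Ideal.span {ϖ} := hϖ.maximalIdeal_eq
  let res : A ⧸ maximalIdeal A ^ 2 →+* ResidueField A :=
    Ideal.Quotient.lift _ (residue A) fun a ha =>
      (residue_eq_zero_iff a).2 (Ideal.pow_le_self two_ne_zero ha)
  have hres : ∀ a, res (Ideal.Quotient.mk _ a) = 0 ↔ ϖ ∣ a := fun a => by
    rw [Ideal.Quotient.lift_mk, residue_eq_zero_iff, hm, Ideal.mem_span_singleton]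
  have hmk : ∀ a, Ideal.Quotient.mk (maximalIdeal A ^ 2) a = 0 ↔ ϖ ^ 2 ∣ a := fun a => by
    rw [Ideal.Quotient.eq_zero_iff_mem, hm, Ideal.span_singleton_pow, Ideal.mem_span_singleton]
  refine ⟨ofGenerator res (Ideal.Quotient.lift_surjective_of_surjective _ _ residue_surjective)
    (Ideal.Quotient.mk _ ϖ) (fun r => ?_) fun r => ?_⟩
  -- Cancelling `ϖ` in the domain: `ϖ ^ 2` divides `a * ϖ` exactly when `ϖ` divides `a`.
  · obtain ⟨a, rfl⟩ := Ideal.Quotient.mk_surjective r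
    rw [← map_mul, hres, hmk, sq, mul_dvd_mul_iff_right hϖ.ne_zero]
  · obtain ⟨a, rfl⟩ := Ideal.Quotient.mk_surjective r
    rw [hres]
    refine ⟨fun h => map_dvd _ h, ?_⟩
    rintro ⟨s, hs⟩
    obtain ⟨b, rfl⟩ := Ideal.Quotient.mk_surjective s
    rw [← map_mul, ← sub_eq_zero, ← map_sub, hmk] at hs
    exact (dvd_sub_left (dvd_mul_right ϖ b)).1 ((dvd_pow_self ϖ two_ne_zero).trans hs)

end SquareZeroExtension

theorem corollary1p3 (n : ℕ)
    (F : Type*) [Field F] [ValuativeRel F] [TopologicalSpace F] [IsNonarchimedeanLocalField F]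
    (F' : Type*) [Field F'] [ValuativeRel F'] [TopologicalSpace F'] [IsNonarchimedeanLocalField F']
    (hq : Nat.card 𝓀[F] = Nat.card 𝓀[F']) :
    repZeta (GL (Fin n) (OTwo F)) = repZeta (GL (Fin n) (OTwo F')) ∧
      irrDims (GL (Fin n) (OTwo F)) = irrDims (GL (Fin n) (OTwo F')) := by
  have := Fintype.ofFinite 𝓀[F]
  have := Fintype.ofFinite 𝓀[F']
  obtain ⟨E⟩ := SquareZeroExtension.nonempty_of_isDiscreteValuationRing 𝒪[F]
  obtain ⟨E'⟩ := SquareZeroExtension.nonempty_of_isDiscreteValuationRing 𝒪[F']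
  have e : 𝓀[F] ≃+* 𝓀[F'] := FiniteField.ringEquivOfCardEq
    (by rwa [← Nat.card_eq_fintype_card, ← Nat.card_eq_fintype_card])
  have : Finite (𝒪[F] ⧸ 𝓂[F] ^ 2) := OTwo.finite F
  have : Finite (𝒪[F'] ⧸ 𝓂[F'] ^ 2) := OTwo.finite F'
  -- Once both extensions have the residue field of `F'`, the same semidirect product mediates
  -- between the two group algebras.
  obtain ⟨α⟩ := (E.congrResidue e).nonempty_algEquiv_gl (Fin n)
  obtain ⟨α'⟩ := E'.nonempty_algEquiv_gl (Fin n)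
  exact ⟨repZeta_eq_of_algEquiv (α.symm.trans α'), irrDims_eq_of_algEquiv (α.symm.trans α')⟩
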